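/- Let $\lambda,\lambda',\xi,\xi',\gamma,\rho,p,b,c,\mu\in\mathbb{C}$ with $\Re(\gamma)\ge -1$, let $a\in\mathbb{N}$ (the value $0$ is allowed), let $\eta>0$ and $\alpha>0$ be real, and let $x>0$. Generalized Struve function: $${}_a\mathcal{W}^{\alpha,\mu}_{p,b,c,\eta}(z)=\sum_{k=0}^\infty\frac{(-c)^k}{\Gamma(\alpha k+\mu)\,\Gamma\!\left(ak+\frac p\eta+\frac{b+2}2\right)}\left(\frac z2\right)^{2k+p+1},$$ with $1/\Gamma=0$ at the poles of $\Gamma$. Right-sided Marichev–Saigo–Maeda operators: for $\Re(\gamma)>0$, $$\bigl(I_-^{\lambda,\lambda',\xi,\xi',\gamma}f\bigr)(x)=\frac{x^{-\lambda'}}{\Gamma(\gamma)}\int_x^\infty (t-x)^{\gamma-1}t^{-\lambda}F_3\!\left(\lambda,\lambda',\xi,\xi';\gamma;1-\frac xt,1-\frac tx\right)f(t)\,dt,$$ where $F_3(a,a',b,b';c;X,Y)=\sum_{m,n\ge0}\frac{(a)_m(a')_n(b)_m(b')_n}{(c)_{m+n}}\frac{X^mY^n}{m!\,n!}$ is Appell's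 function, continued analytically to $|X|<1$, $Y<0$. For $\Re(\gamma)\ge-1$, with $n=[\Re(\gamma)]+1$ and $[\,\cdot\,]$ the floor, $$\bigl(D_-^{\lambda,\lambda',\xi,\xi',\gamma}f\bigr)(x)=\left(-\frac{d}{dx}\right)^{n}\bigl(I_-^{-\lambda',-\lambda,-\xi',-\xi+n,-\gamma+n}f\bigr)(x).$$ Fox–Wright function: $${}_r\Psi_s\!\left[\begin{matrix}(a_i,\alpha_i)_{1,r}\\(b_j,\beta_j)_{1,s}\end{matrix};z\right]=\sum_{k=0}^\infty\frac{\prod_{i}\Gamma(a_i+\alpha_ik)}{\prod_{j}\Gamma(b_j+\beta_jk)}\frac{z^k}{k!}.$$ Theorem. Let $f(t)=t^{-\rho}\,{}_a\mathcal{W}^{\alpha,\mu}_{p,b,c,\eta}(1/t)$, $t>0$. Suppose that the integral defining $\bigl(I_-^{-\lambda',-\lambda,-\xi',-\xi+n,-\gamma+n}f\bigr)(y)$ converges absolutely for all $y$ in a neighbourhood of $x$, and that no Gamma factor in the numerators of the Fox–Wright series below is evaluated at a pole. Then $I_-^{-\lambda',-\lambda,-\xi',-\xi+n,-\gamma+n}f$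 is of class $C^n$ near $x$, the Fox–Wright series below converges absolutely, and $$\bigl(D_-^{\lambda,\lambda',\xi,\xi',\gamma}f\bigr)(x)=\frac{x^{\lambda+\lambda'-\gamma-\rho-p-1}}{2^{p+1}}\;{}_4\Psi_5\!\left[\begin{matrix}(1,1),\ (\xi'+\rho+p+1,2),\ (-\lambda-\lambda'+\gamma+\rho+p+1,2),\ (-\lambda'-\xi+\gamma+\rho+p+1,2)\\ (\mu,\alpha),\ \left(\frac p\eta+\frac{b+2}2,a\right),\ (\rho+p+1,2),\ (-\lambda'+\xi'+\rho+p+1,2),\ (-\lambda-\lambda'-\xi+\gamma+\rho+p+1,2)\end{matrix};\,-\frac{c}{4x^2}\right].$$ -/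

import Mathlib

open Filter Topology MeasureTheory Set

noncomputable section

/-- The generalized Struve function
`∑ k, (-c)^k / (Γ(α k + μ) Γ(a k + p/η + (b+2)/2)) * (z/2)^(2k+p+1)`
(principal branch of the complex power; `1/Γ` is `0` at the poles of `Γ`). -/
def genStruve (a : ℕ) (p b c : ℂ) (η α : ℝ) (μ : ℂ) (z : ℂ) : ℂ :=
  ∑' k : ℕ, (-c) ^ k /
      (Complex.Gamma ((α : ℂ) * k + μ) *
        Complex.Gamma ((a : ℂ) * k + p / (η : ℂ) + (b + 2) / 2)) *
    (z / 2) ^ (2 * (k : ℂ) + p + 1)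

/-- The `k`-th term of the Fox–Wright series with upper parameters `A i = (a_i, α_i)` and lower
parameters `B j = (b_j, β_j)`. -/
def foxWrightTerm {m n : ℕ} (A : Fin m → ℂ × ℝ) (B : Fin n → ℂ × ℝ) (z : ℂ) (k : ℕ) : ℂ :=
  (∏ i, Complex.Gamma ((A i).1 + ((A i).2 : ℂ) * k)) /
      (∏ j, Complex.Gamma ((B j).1 + ((B j).2 : ℂ) * k)) *
    (z ^ k / (k.factorial : ℂ))

/-- The Fox–Wright function `ₘΨₙ`. -/
def foxWright {m n : ℕ} (A : Fin m → ℂ × ℝ) (B : Fin n → ℂ × ℝ) (z : ℂ) : ℂ :=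
  ∑' k : ℕ, foxWrightTerm A B z k

/-- No Gamma factor in the numerators of the Fox–Wright series is evaluated at a pole. -/
def FoxWrightDefined {m : ℕ} (A : Fin m → ℂ × ℝ) : Prop :=
  ∀ (i : Fin m) (k l : ℕ), (A i).1 + ((A i).2 : ℂ) * k ≠ -(l : ℂ)

/-- The principal branch of the Gauss hypergeometric function on `{‖z‖ < 1} ∪ {re z < 1/2}`:
the hypergeometric series on the unit disc, and outside the disc its analytic continuation
`(1 - z)^(-a) ₂F₁(a, c - b; c; z / (z - 1))`, where `‖z / (z - 1)‖ < 1` since `re z < 1/2`. -/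
def gaussF (a b c z : ℂ) : ℂ :=
  if ‖z‖ < 1 then ₂F₁ a b c z else (1 - z) ^ (-a) * ₂F₁ a (c - b) c (z / (z - 1))

/-- Appell's function
`F₃(a, a', b, b'; c; X, Y) = ∑ (a)_m (a')_n (b)_m (b')_n / ((c)_(m+n) m! n!) X^m Y^n`.
Since `(c)_(m+n) = (c)_m (c+m)_n`, the sum over `n` is `₂F₁(a', b'; c + m; Y)`; with the continued
Gauss function in its place this is the analytic continuation of `F₃` to `‖X‖ < 1` and `‖Y‖ < 1` or
`re Y < 1/2`. -/
def appellF3 (a a' b b' c X Y : ℂ) : ℂ :=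
  ∑' m : ℕ, (ascPochhammer ℂ m).eval a * (ascPochhammer ℂ m).eval b /
      ((ascPochhammer ℂ m).eval c * (m.factorial : ℂ)) * X ^ m * gaussF a' b' (c + m) Y

/-- The integrand of the right-sided Marichev–Saigo–Maeda integral at the point `x`. For `t > x > 0`
the arguments of `F₃` satisfy `0 < 1 - x/t < 1` and `1 - t/x < 0`. -/
def rightMSMIntegrand (lam lam' ξ ξ' γ : ℂ) (f : ℝ → ℂ) (x t : ℝ) : ℂ :=
  ((t - x : ℝ) : ℂ) ^ (γ - 1) * (t : ℂ) ^ (-lam) *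
    appellF3 lam lam' ξ ξ' γ ((1 - x / t : ℝ) : ℂ) ((1 - t / x : ℝ) : ℂ) * f t

/-- The right-sided Marichev–Saigo–Maeda fractional integral (for `re γ > 0` and `x > 0`). -/
def rightMSMIntegral (lam lam' ξ ξ' γ : ℂ) (f : ℝ → ℂ) (x : ℝ) : ℂ :=
  (x : ℂ) ^ (-lam') / Complex.Gamma γ * ∫ t in Ioi x, rightMSMIntegrand lam lam' ξ ξ' γ f x t

/-- The order `[re γ] + 1` of differentiation (a natural number for `re γ ≥ -1`). -/
def msmOrder (γ : ℂ) : ℕ := (⌊γ.re⌋ + 1).toNat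

/-- The fractional integral that is differentiated in the right-sided fractional derivative. -/
def rightMSMDerivIntegral (lam lam' ξ ξ' γ : ℂ) (f : ℝ → ℂ) : ℝ → ℂ :=
  rightMSMIntegral (-lam') (-lam) (-ξ') (-ξ + msmOrder γ) (-γ + msmOrder γ) f

/-- The integral defining `rightMSMDerivIntegral` converges absolutely at the point `x`. -/
def RightMSMDerivIntegrable (lam lam' ξ ξ' γ : ℂ) (f : ℝ → ℂ) (x : ℝ) : Prop :=
  IntegrableOn
    (rightMSMIntegrand (-lam') (-lam) (-ξ') (-ξ + msmOrder γ) (-γ + msmOrder γ) f x) (Ioi x)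

/-- The right-sided Marichev–Saigo–Maeda fractional derivative: `(-d/dx)^([re γ] + 1)` of the
fractional integral `rightMSMDerivIntegral`. -/
def rightMSMDeriv (lam lam' ξ ξ' γ : ℂ) (f : ℝ → ℂ) (x : ℝ) : ℂ :=
  (-1) ^ msmOrder γ * iteratedDeriv (msmOrder γ) (rightMSMDerivIntegral lam lam' ξ ξ' γ f) x

/-- Upper parameters of the Fox–Wright function in the image formula. -/
def struveUpper (lam lam' ξ ξ' γ ρ p : ℂ) : Fin 4 → ℂ × ℝ :=
  ![(1, 1),
    (ξ' + ρ + p + 1, 2),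
    (-lam - lam' + γ + ρ + p + 1, 2),
    (-lam' - ξ + γ + ρ + p + 1, 2)]

/-- Lower parameters of the Fox–Wright function in the image formula. -/
def struveLower (lam lam' ξ ξ' γ ρ : ℂ) (a : ℕ) (p b : ℂ) (η α : ℝ) (μ : ℂ) : Fin 5 → ℂ × ℝ :=
  ![(μ, α),
    (p / (η : ℂ) + (b + 2) / 2, (a : ℝ)),
    (ρ + p + 1, 2),
    (-lam' + ξ' + ρ + p + 1, 2),
    (-lam - lam' - ξ + γ + ρ + p + 1, 2)]

end

/-!
After the substitution `t = x u` the right-sided Marichev–Saigo–Maeda integral is an integral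
against a fixed kernel `K` on `(1, ∞)`, so that it sends `t ^ (-s)` to a power of `x` times the
moment `∫ K(u) u ^ (-s) du`. For `re s` large, Pfaff's transformation expands `F₃` in powers of
`1 - 1 / u`, each of which contributes a Beta integral, and two applications of Gauss's summation
theorem turn the moment into a quotient of Gamma functions; analytic continuation in `s` carries
this to every `s` at which the moment converges absolutely.

The function `f` is a series `∑ D k * t ^ (-(s + 2 * k))` with entire coefficients. Its leading term
dominates `K` at infinity exactly as `f` does, so absolute convergence of the fractional integral of
`f` at a single point makes all the moments in question converge, and `f` may be integrated term by
term at every point. Differentiating the result `n` times multiplies its terms by Pochhammer symbols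
`(e + 2 * k)_n`, which are absorbed through `1 / Γ(z) = (z)_n / Γ(z + n)`.
-/

/-! ### Pochhammer symbols -/

section Pochhammer

/-- The Pochhammer symbol `(a)_n = a (a + 1) ⋯ (a + n - 1)`, a short form of the value of
`ascPochhammer`, in which the hypergeometric coefficients below are written. -/
noncomputable def poch {K : Type*} [Semiring K] (a : K) (n : ℕ) : K := (ascPochhammer K n).eval a

@[simp]
theorem poch_zero {K : Type*} [Semiring K] (a : K) : poch a 0 = 1 := by
  simp only [poch, ascPochhammer_zero, Polynomial.eval_one]

theorem poch_succ {K : Type*} [Semiring K] (a : K) (n : ℕ) :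
    poch a (n + 1) = poch a n * (a + n) :=
  ascPochhammer_succ_eval n a

theorem poch_add {K : Type*} [CommSemiring K] (a : K) (m n : ℕ) :
    poch a (m + n) = poch a m * poch (a + m) n := by
  rw [poch, ← ascPochhammer_mul, Polynomial.eval_mul, Polynomial.eval_comp]
  simp only [poch, Polynomial.eval_add, Polynomial.eval_X, Polynomial.eval_natCast]

theorem poch_succ_left {K : Type*} [CommSemiring K] (a : K) (n : ℕ) :
    poch a (n + 1) = a * poch (a + 1) n := by
  simpa [poch_succ, add_comm] using poch_add a 1 n

theorem poch_add_one_mul {K : Type*} [CommSemiring K] (a : K) (n : ℕ) :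
    poch (a + 1) n * a = poch a n * (a + n) := by
  rw [← poch_succ, poch_succ_left, mul_comm]

theorem poch_eq_prod_range {K : Type*} [CommSemiring K] (a : K) (n : ℕ) :
    poch a n = ∏ j ∈ Finset.range n, (a + j) := by
  induction n with
  | zero => simp
  | succ n ih => rw [poch_succ, Finset.prod_range_succ, ih]

theorem map_poch {K L : Type*} [Semiring K] [Semiring L] (φ : K →+* L) (a : K) (n : ℕ) :
    φ (poch a n) = poch (φ a) n := by
  induction n with
  | zero => simp
  | succ n ih => rw [poch_succ, poch_succ, map_mul, map_add, map_natCast, ih]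

theorem poch_nonneg {K : Type*} [Semiring K] [PartialOrder K] [IsOrderedRing K] {a : K}
    (ha : 0 ≤ a) (n : ℕ) : 0 ≤ poch a n := by
  induction n with
  | zero => simp
  | succ n ih =>
    rw [poch_succ]
    positivity

theorem poch_le_poch {K : Type*} [Semiring K] [PartialOrder K] [IsOrderedRing K] {a b : K}
    (ha : 0 ≤ a) (hab : a ≤ b) (n : ℕ) : poch a n ≤ poch b n := by
  induction n with
  | zero => simp
  | succ n ih =>
    rw [poch_succ, poch_succ]
    have := poch_nonneg (ha.trans hab) n
    gcongr

theorem norm_poch_le {K : Type*} [NormedRing K] [NormOneClass K] {a : K} {r : ℝ} (ha : ‖a‖ ≤ r)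
    (n : ℕ) : ‖poch a n‖ ≤ poch r n := by
  induction n with
  | zero => simp
  | succ n ih =>
    rw [poch_succ, poch_succ]
    have hn : ‖a + n‖ ≤ r + n :=
      (norm_add_le _ _).trans (add_le_add ha (by simpa using Nat.norm_cast_le (α := K) n))
    exact (norm_mul_le _ _).trans
      (mul_le_mul ih hn (norm_nonneg _) (poch_nonneg ((norm_nonneg a).trans ha) n))

theorem poch_pos_of_pos {a : ℝ} (ha : 0 < a) (n : ℕ) : 0 < poch a n :=
  ascPochhammer_pos n a ha

theorem poch_re_le_norm {c : ℂ} (hc : 0 < c.re) (n : ℕ) : poch c.re n ≤ ‖poch c n‖ := by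
  induction n with
  | zero => simp
  | succ n ih =>
    rw [poch_succ, poch_succ, norm_mul]
    have h : c.re + n ≤ ‖c + n‖ := by simpa using Complex.re_le_norm (c + n)
    exact mul_le_mul ih h (by positivity) (norm_nonneg _)

theorem poch_ne_zero_of_re_pos {c : ℂ} (hc : 0 < c.re) (n : ℕ) : poch c n ≠ 0 :=
  norm_pos_iff.1 ((poch_pos_of_pos hc n).trans_le (poch_re_le_norm hc n))

theorem tendsto_norm_poch_add_natCast (c : ℂ) (n : ℕ) :
    Tendsto (fun N : ℕ => ‖poch (c + N) (n + 1)‖) atTop atTop := by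
  have hdeg : 0 < (ascPochhammer ℂ (n + 1)).degree :=
    Polynomial.natDegree_pos_iff_degree_pos.1 (by simp [ascPochhammer_natDegree])
  exact Polynomial.tendsto_norm_atTop _ hdeg <|
    tendsto_atTop_add_const_left atTop c.re tendsto_natCast_atTop_atTop |>.mono_left le_rfl |>
      tendsto_atTop_mono fun N => by simpa using Complex.re_le_norm (c + N)

/-- The identity `1 / Γ(z) = (z)_n / Γ(z + n)` also holds at the poles of `Γ`, where Mathlib's
`Γ` and hence `Γ⁻¹` take the value `0`. -/
theorem inv_Gamma_eq_poch_mul (z : ℂ) (n : ℕ) :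
    (Complex.Gamma z)⁻¹ = poch z n * (Complex.Gamma (z + n))⁻¹ := by
  induction n with
  | zero => simp
  | succ n ih =>
    rw [ih, Complex.one_div_Gamma_eq_self_mul_one_div_Gamma_add_one (z + n), poch_succ,
      Nat.cast_succ, mul_assoc, add_assoc z]

theorem Gamma_add_natCast {z : ℂ} (hz : 0 < z.re) (n : ℕ) :
    Complex.Gamma (z + n) = poch z n * Complex.Gamma z := by
  have h := inv_Gamma_eq_poch_mul z n
  have hz0 := Complex.Gamma_ne_zero_of_re_pos hz
  have hzn : Complex.Gamma (z + n) ≠ 0 :=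
    Complex.Gamma_ne_zero_of_re_pos (by rw [Complex.add_re, Complex.natCast_re]; positivity)
  field_simp at h
  rw [h, mul_comm]

theorem tendsto_poch_succ_div (z : ℂ) :
    Tendsto (fun n : ℕ => poch z (n + 1) / ((n : ℂ) ^ z * n.factorial)) atTop
      (𝓝 (Complex.Gamma z)⁻¹) := by
  by_cases hz : Complex.Gamma z = 0
  · obtain ⟨m, rfl⟩ := (Complex.Gamma_eq_zero_iff z).1 hz
    rw [hz, inv_zero]
    refine tendsto_const_nhds.congr' ?_
    filter_upwards [eventually_ge_atTop m] with n hn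
    rw [poch, ascPochhammer_eval_neg_coe_nat_of_lt (Nat.lt_succ_of_le hn), zero_div]
  · refine ((Complex.GammaSeq_tendsto_Gamma z).inv₀ hz).congr fun n => ?_
    rw [Complex.GammaSeq, inv_div, poch_eq_prod_range]

end Pochhammer

/-! ### Gauss's summation theorem -/

section Gauss

/-- The coefficient `(a)_n (b)_n / (n! (c)_n)` of the Gauss hypergeometric series. -/
noncomputable def hypCoeff {K : Type*} [Field K] (a b c : K) (n : ℕ) : K :=
  poch a n * poch b n / (n.factorial * poch c n)

theorem map_hypCoeff {K L : Type*} [Field K] [Field L] (φ : K →+* L) (a b c : K) (n : ℕ) :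
    φ (hypCoeff a b c n) = hypCoeff (φ a) (φ b) (φ c) n := by
  simp only [hypCoeff, map_div₀, map_mul, map_poch, map_natCast]

theorem norm_hypCoeff_le {a b c : ℂ} {A B r : ℝ} (ha : ‖a‖ ≤ A) (hb : ‖b‖ ≤ B) (hr : 0 < r)
    (hc : r ≤ c.re) (n : ℕ) : ‖hypCoeff a b c n‖ ≤ hypCoeff A B r n := by
  have hpa := norm_poch_le ha n
  have hpb := norm_poch_le hb n
  have hpc : poch r n ≤ ‖poch c n‖ :=
    (poch_le_poch hr.le hc n).trans (poch_re_le_norm (hr.trans_le hc) n)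
  have := poch_pos_of_pos hr n
  have := (norm_nonneg _).trans hpa
  have := (norm_nonneg _).trans hpb
  simp only [hypCoeff, norm_div, norm_mul, Complex.norm_natCast]
  gcongr

theorem tendsto_succ_mul_hypCoeff_succ {c : ℂ} (hc : 0 < c.re) (a b : ℂ) :
    Tendsto (fun n : ℕ => ((n + 1 : ℕ) : ℂ) * hypCoeff a b c (n + 1) / (n : ℂ) ^ (a + b - c)) atTop
      (𝓝 (Complex.Gamma c / (Complex.Gamma a * Complex.Gamma b))) := by
  have hΓc := Complex.Gamma_ne_zero_of_re_pos hc
  have h := ((tendsto_poch_succ_div a).mul (tendsto_poch_succ_div b)).div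
    (tendsto_poch_succ_div c) (inv_ne_zero hΓc)
  rw [← mul_inv, div_inv_eq_mul, inv_mul_eq_div] at h
  refine h.congr' ?_
  filter_upwards [eventually_ne_atTop 0] with n hn
  have hn' : (n : ℂ) ≠ 0 := Nat.cast_ne_zero.2 hn
  have hpow : ∀ w : ℂ, (n : ℂ) ^ w ≠ 0 := fun w => by simp [Complex.cpow_eq_zero_iff, hn']
  have hfac : (n.factorial : ℂ) ≠ 0 := Nat.cast_ne_zero.2 n.factorial_ne_zero
  have hpc := poch_ne_zero_of_re_pos hc (n + 1)
  have hsucc : ((n + 1 : ℕ) : ℂ) ≠ 0 := Nat.cast_ne_zero.2 n.succ_ne_zero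
  have ha := hpow a
  have hb := hpow b
  have hc' := hpow c
  simp only [hypCoeff, Pi.div_apply]
  rw [Complex.cpow_sub _ _ hn', Complex.cpow_add _ _ hn', Nat.factorial_succ, Nat.cast_mul]
  field_simp

theorem succ_mul_hypCoeff_succ_isBigO {c : ℂ} (hc : 0 < c.re) (a b : ℂ) :
    (fun n : ℕ => ((n + 1 : ℕ) : ℂ) * hypCoeff a b c (n + 1)) =O[atTop]
      fun n : ℕ => (n : ℝ) ^ (a + b - c).re := by
  have hpow : ∀ᶠ n : ℕ in atTop, ‖(n : ℂ) ^ (a + b - c)‖ = ‖(n : ℝ) ^ (a + b - c).re‖ := by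
    filter_upwards [eventually_gt_atTop 0] with n hn
    rw [Complex.norm_natCast_cpow_of_pos hn, Real.norm_of_nonneg (by positivity)]
  have hne : ∀ᶠ n : ℕ in atTop, (n : ℂ) ^ (a + b - c) = 0 →
      ((n + 1 : ℕ) : ℂ) * hypCoeff a b c (n + 1) = 0 := by
    filter_upwards [eventually_ne_atTop 0] with n hn h
    exact absurd h (by simp [Complex.cpow_eq_zero_iff, hn])
  exact (Asymptotics.isBigO_of_div_tendsto_nhds hne _
    (tendsto_succ_mul_hypCoeff_succ hc a b)).trans
      (.of_bound 1 (hpow.mono fun n h => by rw [h, one_mul]))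

theorem summable_norm_hypCoeff {a b c : ℂ} (hc : 0 < c.re) (hab : (a + b).re < c.re) :
    Summable fun n => ‖hypCoeff a b c n‖ := by
  rw [← summable_nat_add_iff 1]
  refine summable_of_isBigO_nat (g := fun n : ℕ => (n : ℝ) ^ ((a + b - c).re - 1))
    (Real.summable_nat_rpow.2 (by rw [Complex.sub_re]; linarith)) ?_
  have hinv : (fun n : ℕ => (((n + 1 : ℕ) : ℂ))⁻¹) =O[atTop] fun n : ℕ => (n : ℝ) ^ (-1 : ℝ) := by
    refine .of_bound 1 ?_
    filter_upwards [eventually_gt_atTop 0] with n hn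
    rw [norm_inv, Complex.norm_natCast, Real.rpow_neg_one, norm_inv, Real.norm_natCast, one_mul]
    have : (0 : ℝ) < n := Nat.cast_pos.2 hn
    gcongr
    exact n.le_succ
  refine ((hinv.mul (succ_mul_hypCoeff_succ_isBigO hc a b)).congr' ?_ ?_).norm_left
  · filter_upwards with n
    exact inv_mul_cancel_left₀ (Nat.cast_ne_zero.2 n.succ_ne_zero) _
  · filter_upwards [eventually_gt_atTop 0] with n hn
    rw [← Real.rpow_add (Nat.cast_pos.2 hn)]
    ring_nf

theorem tendsto_natCast_mul_hypCoeff {a b c : ℂ} (hc : 0 < c.re) (hab : (a + b).re < c.re) :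
    Tendsto (fun n : ℕ => (n : ℂ) * hypCoeff a b c n) atTop (𝓝 0) := by
  rw [← tendsto_add_atTop_iff_nat 1]
  refine (succ_mul_hypCoeff_succ_isBigO hc a b).trans_tendsto ?_
  have hneg : 0 < -(a + b - c).re := by rw [Complex.sub_re]; linarith
  simpa only [neg_neg, Function.comp_def] using
    (tendsto_rpow_neg_atTop hneg).comp tendsto_natCast_atTop_atTop

theorem hypCoeff_telescope {c : ℂ} (hc : 0 < c.re) (a b : ℂ) (n : ℕ) :
    c * (c - a - b) * hypCoeff a b c n - (c - a) * (c - b) * hypCoeff a b (c + 1) n =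
      c * (n * hypCoeff a b c n - ((n + 1 : ℕ) : ℂ) * hypCoeff a b c (n + 1)) := by
  have hc0 : c ≠ 0 := by rintro rfl; simp at hc
  have hp := poch_ne_zero_of_re_pos hc n
  have hp1 : poch (c + 1) n ≠ 0 :=
    poch_ne_zero_of_re_pos (by rw [Complex.add_re, Complex.one_re]; linarith) n
  have hfac : (n.factorial : ℂ) ≠ 0 := Nat.cast_ne_zero.2 n.factorial_ne_zero
  have hsucc : ((n + 1 : ℕ) : ℂ) ≠ 0 := Nat.cast_ne_zero.2 n.succ_ne_zero
  have hmul : c * hypCoeff a b c n = (c + n) * hypCoeff a b (c + 1) n := by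
    have := poch_add_one_mul c n
    simp only [hypCoeff]
    field_simp
    linear_combination (poch a n * poch b n) * this
  have hsucc_mul : c * (((n + 1 : ℕ) : ℂ) * hypCoeff a b c (n + 1)) =
      (a + n) * (b + n) * hypCoeff a b (c + 1) n := by
    simp only [hypCoeff]
    rw [poch_succ a, poch_succ b, poch_succ_left c, Nat.factorial_succ, Nat.cast_mul]
    field_simp
  linear_combination (c - a - b - n) * hmul + hsucc_mul

theorem tsum_hypCoeff_add_one {a b c : ℂ} (hc : 0 < c.re) (hab : (a + b).re < c.re) :
    c * (c - a - b) * ∑' n, hypCoeff a b c n =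
      (c - a) * (c - b) * ∑' n, hypCoeff a b (c + 1) n := by
  have hS := (summable_norm_hypCoeff hc hab).of_norm.hasSum.mul_left (c * (c - a - b))
  have hS1 := (summable_norm_hypCoeff (a := a) (b := b) (c := c + 1)
    (by rw [Complex.add_re, Complex.one_re]; linarith)
    (by rw [Complex.add_re c, Complex.one_re]; linarith)).of_norm.hasSum.mul_left
      ((c - a) * (c - b))
  have hdiff := (hS.sub hS1).tendsto_sum_nat
  have htelescope : ∀ N : ℕ, ∑ n ∈ Finset.range N, (c * (c - a - b) * hypCoeff a b c n -
      (c - a) * (c - b) * hypCoeff a b (c + 1) n) = c * -(N * hypCoeff a b c N) := by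
    intro N
    simp only [hypCoeff_telescope hc, ← Finset.mul_sum]
    rw [Finset.sum_range_sub' (fun n : ℕ => (n : ℂ) * hypCoeff a b c n)]
    simp
  simp only [htelescope] at hdiff
  have hzero := (tendsto_natCast_mul_hypCoeff hc hab).neg.const_mul c
  rw [neg_zero, mul_zero] at hzero
  exact sub_eq_zero.1 (tendsto_nhds_unique hdiff hzero)

theorem tsum_hypCoeff_eq_mul_tsum_add_natCast {a b c : ℂ} (hc : 0 < c.re)
    (hab : (a + b).re < c.re) (N : ℕ) :
    ∑' n, hypCoeff a b c n = poch (c - a) N * poch (c - b) N / (poch c N * poch (c - a - b) N) *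
      ∑' n, hypCoeff a b (c + N) n := by
  have hcab : 0 < (c - a - b).re := by
    rw [sub_sub, Complex.sub_re]
    linarith
  induction N with
  | zero => simp
  | succ N ih =>
    have hcN : 0 < (c + N).re := by rw [Complex.add_re, Complex.natCast_re]; positivity
    have hcabN : 0 < (c - a - b + N).re := by rw [Complex.add_re, Complex.natCast_re]; positivity
    have hne : ∀ {z : ℂ}, 0 < z.re → z ≠ 0 := by rintro _ h rfl; simp at h
    have h := tsum_hypCoeff_add_one (a := a) (b := b) hcN
      (by rw [Complex.add_re c, Complex.natCast_re]; linarith [N.cast_nonneg (α := ℝ)])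
    have hp := poch_ne_zero_of_re_pos hc N
    have hpab := poch_ne_zero_of_re_pos hcab N
    have h1 := hne hcN
    have h2 := hne hcabN
    rw [ih]
    simp only [poch_succ, Nat.cast_succ, ← add_assoc]
    field_simp
    linear_combination (poch (c - a) N * poch (c - b) N) * h

theorem tendsto_tsum_hypCoeff_add_natCast (a b c : ℂ) :
    Tendsto (fun N : ℕ => ∑' n, hypCoeff a b (c + N) n) atTop (𝓝 1) := by
  have hsingle : (1 : ℂ) = ∑' n : ℕ, if n = 0 then 1 else 0 := by simp
  set r : ℝ := ‖a‖ + ‖b‖ + 1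
  have hr : 0 < r := by positivity
  have hbound : Summable fun n => hypCoeff ‖a‖ ‖b‖ r n := by
    have h := (summable_norm_hypCoeff (a := ‖a‖) (b := ‖b‖) (c := r) (by simpa using hr)
      (by simp [r])).of_norm
    refine Complex.summable_ofReal.1 (h.congr fun n => ?_)
    exact (map_hypCoeff Complex.ofRealHom ‖a‖ ‖b‖ r n).symm
  rw [hsingle]
  refine tendsto_tsum_of_dominated_convergence hbound ?_ ?_
  · rintro (_ | n)
    · simp [hypCoeff]
    · rw [if_neg n.succ_ne_zero, tendsto_zero_iff_norm_tendsto_zero]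
      have h := (tendsto_norm_poch_add_natCast c n).inv_tendsto_atTop.const_mul
        ‖poch a (n + 1) * poch b (n + 1) / (n + 1).factorial‖
      rw [mul_zero] at h
      refine h.congr fun N => ?_
      rw [Pi.inv_apply, hypCoeff, ← div_div, norm_div _ (poch (c + N) (n + 1)),
        ← div_eq_mul_inv]
  · have hlarge : ∀ᶠ N : ℕ in atTop, r - c.re ≤ N :=
      tendsto_natCast_atTop_atTop.eventually_ge_atTop _
    filter_upwards [hlarge] with N hN n
    exact norm_hypCoeff_le le_rfl le_rfl hr (by rw [Complex.add_re, Complex.natCast_re]; linarith) n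

theorem hasSum_hypCoeff {a b c : ℂ} (hc : 0 < c.re) (hab : (a + b).re < c.re) :
    HasSum (hypCoeff a b c) (Complex.Gamma c * Complex.Gamma (c - a - b) /
      (Complex.Gamma (c - a) * Complex.Gamma (c - b))) := by
  have hcab : 0 < (c - a - b).re := by
    rw [sub_sub, Complex.sub_re]
    linarith
  have hratio : Tendsto (fun N : ℕ => poch (c - a) (N + 1) * poch (c - b) (N + 1) /
      (poch c (N + 1) * poch (c - a - b) (N + 1))) atTop (𝓝 (Complex.Gamma c *
        Complex.Gamma (c - a - b) / (Complex.Gamma (c - a) * Complex.Gamma (c - b)))) := by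
    have h := ((tendsto_poch_succ_div (c - a)).mul (tendsto_poch_succ_div (c - b))).div
      ((tendsto_poch_succ_div c).mul (tendsto_poch_succ_div (c - a - b)))
      (mul_ne_zero (inv_ne_zero (Complex.Gamma_ne_zero_of_re_pos hc))
        (inv_ne_zero (Complex.Gamma_ne_zero_of_re_pos hcab)))
    rw [← mul_inv, ← mul_inv, inv_div_inv] at h
    refine h.congr' ?_
    filter_upwards [eventually_ne_atTop 0] with n hn
    have hn' : (n : ℂ) ≠ 0 := Nat.cast_ne_zero.2 hn
    have hpow : ∀ w : ℂ, (n : ℂ) ^ w ≠ 0 := fun w => by simp [Complex.cpow_eq_zero_iff, hn']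
    have hfac : (n.factorial : ℂ) ≠ 0 := Nat.cast_ne_zero.2 n.factorial_ne_zero
    have ha := hpow a
    have hb := hpow b
    have hc' := hpow c
    simp only [Pi.div_apply]
    rw [Complex.cpow_sub _ b hn', Complex.cpow_sub _ b hn', Complex.cpow_sub _ a hn']
    field_simp
  have hlim := hratio.mul
    ((tendsto_add_atTop_iff_nat 1).2 (tendsto_tsum_hypCoeff_add_natCast a b c))
  simp only [← tsum_hypCoeff_eq_mul_tsum_add_natCast hc hab, mul_one] at hlim
  rw [← tendsto_nhds_unique tendsto_const_nhds hlim]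
  exact (summable_norm_hypCoeff hc hab).of_norm.hasSum

end Gauss

/-! ### The Gauss hypergeometric function and Pfaff's transformation -/

section Hypergeometric

theorem mem_eball_zero_one_iff {z : ℂ} : z ∈ Metric.eball (0 : ℂ) 1 ↔ ‖z‖ < 1 := by
  rw [← ENNReal.ofReal_one, Metric.eball_ofReal, mem_ball_zero_iff]

theorem ordinaryHypergeometric_eq_tsum_hypCoeff (a b c z : ℂ) :
    ₂F₁ a b c z = ∑' n, hypCoeff a b c n * z ^ n := by
  rw [ordinaryHypergeometric_eq_tsum]
  refine tsum_congr fun n => ?_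
  simp only [hypCoeff, poch, smul_eq_mul]
  field_simp

theorem hypCoeff_eq_Gamma_mul_coeff {c : ℂ} (hc : 0 < c.re) (a b : ℂ) (n : ℕ) :
    hypCoeff a b c n = Complex.Gamma c * (a.regularizedGaussHGFunSeries b c).coeff n := by
  have := Complex.Gamma_ne_zero_of_re_pos hc
  have := poch_ne_zero_of_re_pos hc n
  have : (n.factorial : ℂ) ≠ 0 := Nat.cast_ne_zero.2 n.factorial_ne_zero
  rw [Complex.coeff_regularizedGaussHGFunSeries, Gamma_add_natCast hc, hypCoeff]
  simp only [poch] at *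
  field_simp

theorem summable_norm_hypCoeff_mul_pow {c z : ℂ} (hc : 0 < c.re) (hz : ‖z‖ < 1) (a b : ℂ) :
    Summable fun n => ‖hypCoeff a b c n * z ^ n‖ := by
  have h := (a.regularizedGaussHGFunSeries b c).summable_norm_apply
    (Metric.eball_subset_eball (Complex.radius_regularizedGaussHGFunSeries_ge_one a b c)
      (mem_eball_zero_one_iff.2 hz))
  refine (h.mul_left ‖Complex.Gamma c‖).congr fun n => ?_
  rw [hypCoeff_eq_Gamma_mul_coeff hc, FormalMultilinearSeries.apply_eq_pow_smul_coeff, smul_eq_mul,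
    ← norm_mul, mul_comm (z ^ n), mul_assoc]

theorem hasSum_hypCoeff_mul_pow {c z : ℂ} (hc : 0 < c.re) (hz : ‖z‖ < 1) (a b : ℂ) :
    HasSum (fun n => hypCoeff a b c n * z ^ n) (₂F₁ a b c z) := by
  rw [ordinaryHypergeometric_eq_tsum_hypCoeff]
  exact (summable_norm_hypCoeff_mul_pow hc hz a b).of_norm.hasSum

theorem differentiableOn_ordinaryHypergeometric {c : ℂ} (hc : 0 < c.re) (a b : ℂ) :
    DifferentiableOn ℂ (₂F₁ a b c : ℂ → ℂ) (Metric.ball 0 1) := by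
  have hΓ := Complex.Gamma_ne_zero_of_re_pos hc
  have hpoles : ∀ k : ℕ, c ≠ -k := fun k h =>
    hΓ ((Complex.Gamma_eq_zero_iff c).2 ⟨k, h⟩)
  have hradius := Complex.radius_regularizedGaussHGFunSeries_ge_one a b c
  have hreg : DifferentiableOn ℂ (Complex.regularizedGaussHGFun a b c) (Metric.ball 0 1) :=
    ((a.regularizedGaussHGFunSeries b c).hasFPowerSeriesOnBall
      (zero_lt_one.trans_le hradius)).differentiableOn.mono fun z hz =>
        Metric.eball_subset_eball hradius (mem_eball_zero_one_iff.2 (mem_ball_zero_iff.1 hz))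
  refine (hreg.const_mul (Complex.Gamma c)).congr fun z _ => ?_
  rw [← Complex.ordinaryHypergeometric_div_Gamma_eq hpoles, mul_div_cancel₀ _ hΓ]

theorem hasSum_poch_div_factorial_mul_pow {z : ℂ} (hz : ‖z‖ < 1) (a : ℂ) :
    HasSum (fun n : ℕ => poch a n / n.factorial * z ^ n) ((1 - z) ^ (-a)) := by
  have h := (Complex.one_div_one_sub_cpow_hasFPowerSeriesOnBall_zero a).hasSum
    (mem_eball_zero_one_iff.2 hz)
  rw [zero_add, one_div, ← Complex.cpow_neg] at h
  refine h.congr_fun fun n => ?_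
  rw [FormalMultilinearSeries.ofScalars_apply_eq, Ring.choose_eq_smul,
    Polynomial.descPochhammer_smeval_eq_ascPochhammer, Polynomial.ascPochhammer_smeval_cast,
    Polynomial.ascPochhammer_smeval_eq_eval, sub_right_comm, add_sub_cancel_right,
    sub_add_cancel, smul_eq_mul, smul_eq_mul, poch]
  ring

/-- The terms of the expansion of `(1 - z)^(-a) ₂F₁(a, d; c; w / (1 - z))` as a double power series
in `w` and `z`. -/
noncomputable def pfaffTerm {K : Type*} [Field K] (a d c w z : K) (q : ℕ × ℕ) : K :=
  hypCoeff a d c q.1 * w ^ q.1 * (poch (a + q.1) q.2 / q.2.factorial * z ^ q.2)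

theorem map_pfaffTerm {K L : Type*} [Field K] [Field L] (φ : K →+* L) (a d c w z : K)
    (q : ℕ × ℕ) : φ (pfaffTerm a d c w z q) = pfaffTerm (φ a) (φ d) (φ c) (φ w) (φ z) q := by
  simp only [pfaffTerm, map_mul, map_div₀, map_pow, map_add, map_hypCoeff, map_poch, map_natCast]

theorem norm_pfaffTerm_le {c : ℂ} (hc : 0 < c.re) (a d w z : ℂ) (q : ℕ × ℕ) :
    ‖pfaffTerm a d c w z q‖ ≤ pfaffTerm ‖a‖ ‖d‖ c.re ‖w‖ ‖z‖ q := by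
  have hcoeff := norm_hypCoeff_le (le_refl ‖a‖) (le_refl ‖d‖) hc le_rfl q.1
  have hpoch : ‖poch (a + q.1) q.2‖ ≤ poch (‖a‖ + q.1) q.2 :=
    norm_poch_le ((norm_add_le _ _).trans_eq (by rw [Complex.norm_natCast])) q.2
  have := (norm_nonneg _).trans hcoeff
  simp only [pfaffTerm, norm_mul, norm_div, norm_pow, Complex.norm_natCast]
  gcongr

theorem hasSum_pfaffTerm_row {z : ℂ} (hz : ‖z‖ < 1) (a d c w : ℂ) (n : ℕ) :
    HasSum (fun j => pfaffTerm a d c w z (n, j))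
      ((1 - z) ^ (-a) * (hypCoeff a d c n * (w / (1 - z)) ^ n)) := by
  have hz1 : 1 - z ≠ 0 := sub_ne_zero.2 (by rintro rfl; simp at hz)
  have h := (hasSum_poch_div_factorial_mul_pow hz (a + n)).mul_left (hypCoeff a d c n * w ^ n)
  convert! h using 1
  rw [neg_add, Complex.cpow_add _ _ hz1, Complex.cpow_neg _ (n : ℂ), Complex.cpow_natCast, div_pow]
  ring

theorem summable_of_nonneg_of_hasSum_ofReal_row {f : ℕ × ℕ → ℝ} (hf : 0 ≤ f) {g : ℕ → ℂ}
    (hrow : ∀ m, HasSum (fun n => (f (m, n) : ℂ)) (g m)) (hg : Summable g) : Summable f := by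
  have hrow' : ∀ m, Summable fun n => f (m, n) := fun m =>
    Complex.summable_ofReal.1 (hrow m).summable
  refine (summable_prod_of_nonneg hf).2 ⟨hrow', Complex.summable_ofReal.1 (hg.congr fun m => ?_)⟩
  rw [Complex.ofReal_tsum, (hrow m).tsum_eq]

theorem summable_pfaffTerm {c w z : ℂ} (hc : 0 < c.re) (hwz : ‖w‖ < 1 - ‖z‖) (a d : ℂ) :
    Summable (pfaffTerm a d c w z) := by
  have hz0 : 0 < 1 - ‖z‖ := (norm_nonneg w).trans_lt hwz
  have hz : ‖((‖z‖ : ℝ) : ℂ)‖ < 1 := by rw [Complex.norm_real, norm_norm]; linarith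
  have hratio : ‖((‖w‖ : ℝ) : ℂ) / (1 - ((‖z‖ : ℝ) : ℂ))‖ < 1 := by
    rw [← Complex.ofReal_one, ← Complex.ofReal_sub, ← Complex.ofReal_div, Complex.norm_real,
      Real.norm_of_nonneg (by positivity), div_lt_one hz0]
    exact hwz
  refine .of_norm_bounded (g := pfaffTerm ‖a‖ ‖d‖ c.re ‖w‖ ‖z‖) ?_ (norm_pfaffTerm_le hc a d w z)
  refine summable_of_nonneg_of_hasSum_ofReal_row
    (fun q => (norm_nonneg _).trans (norm_pfaffTerm_le hc a d w z q)) (fun n => ?_)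
    ((summable_norm_hypCoeff_mul_pow (c := (c.re : ℂ)) (by simpa using hc) hratio (‖a‖ : ℂ)
      (‖d‖ : ℂ)).of_norm.mul_left ((1 - ((‖z‖ : ℝ) : ℂ)) ^ (-((‖a‖ : ℝ) : ℂ))))
  convert hasSum_pfaffTerm_row hz (‖a‖ : ℂ) (‖d‖ : ℂ) (c.re : ℂ) (‖w‖ : ℂ) n using 2 with j
  exact map_pfaffTerm Complex.ofRealHom _ _ _ _ _ _

theorem chu_vandermonde_poch (b c : ℂ) (N : ℕ) :
    ∑ q ∈ Finset.HasAntidiagonal.antidiagonal N, (-1) ^ q.1 * (N.choose q.1 : ℂ) *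
      (poch (c - b) q.1 * poch (c + q.1) q.2) = poch b N := by
  have hpoch : ∀ (x : ℂ) (n : ℕ), (descPochhammer ℤ n).smeval x = poch (x - n + 1) n :=
    fun x n => by
      rw [Polynomial.descPochhammer_smeval_eq_ascPochhammer,
        Polynomial.ascPochhammer_smeval_eq_eval, poch]
  have hneg : ∀ n : ℕ, (descPochhammer ℤ n).smeval (b - c) = (-1) ^ n * poch (c - b) n :=
    fun n => by
      have h := Polynomial.ascPochhammer_smeval_neg_eq_descPochhammer (b - c) n
      rw [Polynomial.ascPochhammer_smeval_eq_eval, neg_sub] at h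
      rw [poch, h, Int.negOnePow_def, Units.smul_def]
      simp [← mul_assoc, ← mul_pow]
  have h := Ring.descPochhammer_smeval_add (r := b - c) (s := c + N - 1) N (Commute.all _ _)
  rw [hpoch, show b - c + (c + N - 1) - N + 1 = b by ring] at h
  rw [h]
  refine Finset.sum_congr rfl fun q hq => ?_
  have hq' : (q.1 : ℂ) + q.2 = N := by exact_mod_cast Finset.HasAntidiagonal.mem_antidiagonal.1 hq
  rw [hneg, hpoch, ← hq', show c + (q.1 + q.2) - 1 - q.2 + 1 = c + q.1 by ring]
  ring

theorem sum_antidiagonal_pfaffTerm {c : ℂ} (hc : 0 < c.re) (a b z : ℂ) (N : ℕ) :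
    ∑ q ∈ Finset.HasAntidiagonal.antidiagonal N, pfaffTerm a (c - b) c (-z) z q =
      hypCoeff a b c N * z ^ N := by
  rw [hypCoeff, ← chu_vandermonde_poch b c N, Finset.mul_sum, Finset.sum_div,
    Finset.sum_mul]
  refine Finset.sum_congr rfl fun q hq => ?_
  have h1 := poch_ne_zero_of_re_pos hc q.1
  have h2 : poch (c + q.1) q.2 ≠ 0 :=
    poch_ne_zero_of_re_pos (by rw [Complex.add_re, Complex.natCast_re]; positivity) q.2
  have hfac : ∀ n : ℕ, (n.factorial : ℂ) ≠ 0 := fun n => Nat.cast_ne_zero.2 n.factorial_ne_zero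
  have := hfac q.1
  have := hfac q.2
  have := hfac (q.1 + q.2)
  rw [← Finset.HasAntidiagonal.mem_antidiagonal.1 hq, pfaffTerm, hypCoeff, poch_add a, poch_add c,
    Nat.cast_add_choose, neg_pow z, pow_add]
  field_simp

theorem pfaff_of_norm_lt_half {c z : ℂ} (hc : 0 < c.re) (hz : ‖z‖ < 1 / 2) (a b : ℂ) :
    ₂F₁ a b c z = (1 - z) ^ (-a) * ₂F₁ a (c - b) c (z / (z - 1)) := by
  have hz1 : ‖z‖ < 1 := by linarith
  have hw : ‖z / (z - 1)‖ < 1 := by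
    have h : 1 - ‖z‖ ≤ ‖z - 1‖ := by
      rw [norm_sub_rev]
      simpa using norm_sub_norm_le (1 : ℂ) z
    rw [norm_div, div_lt_one (by linarith)]
    linarith
  have hsum : HasSum (pfaffTerm a (c - b) c (-z) z) (∑' q, pfaffTerm a (c - b) c (-z) z q) :=
    (summable_pfaffTerm hc (by rw [norm_neg]; linarith) a (c - b)).hasSum
  have hdiag : ∑' q, pfaffTerm a (c - b) c (-z) z q = ₂F₁ a b c z := by
    have h := (Finset.HasAntidiagonal.sigmaAntidiagonalEquivProd.hasSum_iff.2 hsum).sigma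
      fun N => hasSum_fintype _
    refine h.unique ((hasSum_hypCoeff_mul_pow hc hz1 a b).congr_fun fun N => ?_)
    rw [← sum_antidiagonal_pfaffTerm hc a b z N, Finset.univ_eq_attach]
    exact Finset.sum_attach _ (pfaffTerm a (c - b) c (-z) z)
  have hrow := hsum.prod_fiberwise (hasSum_pfaffTerm_row hz1 a (c - b) c (-z))
  have hneg : -z / (1 - z) = z / (z - 1) := by rw [← neg_sub z 1, neg_div_neg_eq]
  simp only [hneg, hdiag] at hrow
  exact hrow.unique ((hasSum_hypCoeff_mul_pow hc hw a (c - b)).mul_left _)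

theorem norm_div_sub_one_lt_one {z : ℂ} (hz : z.re < 1 / 2) : ‖z / (z - 1)‖ < 1 := by
  have hz1 : z - 1 ≠ 0 := sub_ne_zero.2 (by rintro rfl; norm_num at hz)
  rw [norm_div, div_lt_one (norm_pos_iff.2 hz1), ← sq_lt_sq₀ (norm_nonneg _) (norm_nonneg _),
    ← Complex.normSq_eq_norm_sq, ← Complex.normSq_eq_norm_sq, Complex.normSq_apply,
    Complex.normSq_apply, Complex.sub_re, Complex.sub_im, Complex.one_re, Complex.one_im]
  linarith

theorem pfaff_transformation {c z : ℂ} (hc : 0 < c.re) (hz : ‖z‖ < 1) (hz' : z.re < 1 / 2)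
    (a b : ℂ) :
    ₂F₁ a b c z = (1 - z) ^ (-a) * ₂F₁ a (c - b) c (z / (z - 1)) := by
  set U : Set ℂ := Metric.ball 0 1 ∩ {w : ℂ | w.re < 1 / 2} with hU
  have hUo : IsOpen U := Metric.isOpen_ball.inter (isOpen_lt Complex.continuous_re continuous_const)
  have hUc : Convex ℝ U := (convex_ball _ _).inter (convex_halfSpace_re_lt _)
  have hL : DifferentiableOn ℂ (₂F₁ a b c : ℂ → ℂ) U :=
    (differentiableOn_ordinaryHypergeometric hc a b).mono inter_subset_left
  have hR : DifferentiableOn ℂ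
      (fun w : ℂ => (1 - w) ^ (-a) * ₂F₁ a (c - b) c (w / (w - 1))) U := by
    have hre : ∀ w ∈ U, w.re < 1 / 2 := fun w hw => hw.2
    refine DifferentiableOn.mul (fun w hw => ?_) ?_
    · refine (DifferentiableAt.cpow_const (by fun_prop) (.inl ?_)).differentiableWithinAt
      rw [Complex.sub_re, Complex.one_re]
      linarith [hre w hw]
    · refine (differentiableOn_ordinaryHypergeometric hc a (c - b)).comp (fun w hw => ?_)
        fun w hw => mem_ball_zero_iff.2 (norm_div_sub_one_lt_one (hre w hw))
      have hw1 : w - 1 ≠ 0 := sub_ne_zero.2 fun h => by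
        have := h ▸ hre w hw
        norm_num at this
      have hdiv : DifferentiableAt ℂ (fun w : ℂ => w / (w - 1)) w := by
        fun_prop (disch := assumption)
      exact hdiv.differentiableWithinAt
  have hnear : ∀ᶠ w : ℂ in 𝓝 0,
      ₂F₁ a b c w = (1 - w) ^ (-a) * ₂F₁ a (c - b) c (w / (w - 1)) := by
    filter_upwards [Metric.ball_mem_nhds (0 : ℂ) one_half_pos] with w hw
    exact pfaff_of_norm_lt_half hc (mem_ball_zero_iff.1 hw) a b
  exact (hL.analyticOnNhd hUo).eqOn_of_preconnected_of_eventuallyEq (hR.analyticOnNhd hUo)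
    hUc.isPreconnected (by simp [hU]) hnear ⟨mem_ball_zero_iff.2 hz, hz'⟩

theorem gaussF_one_sub_ofReal {c : ℂ} (hc : 0 < c.re) (a b : ℂ) {u : ℝ} (hu : 1 < u) :
    gaussF a b c ((1 - u : ℝ) : ℂ) =
      (u : ℂ) ^ (-a) * ₂F₁ a (c - b) c ((1 - 1 / u : ℝ) : ℂ) := by
  have hu0 : (u : ℂ) ≠ 0 := Complex.ofReal_ne_zero.2 (by linarith)
  have h1 : (1 : ℂ) - ((1 - u : ℝ) : ℂ) = u := by push_cast; ring
  have h2 : ((1 - u : ℝ) : ℂ) / (((1 - u : ℝ) : ℂ) - 1) = ((1 - 1 / u : ℝ) : ℂ) := by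
    rw [← neg_sub 1 ((1 - u : ℝ) : ℂ), h1]
    push_cast
    field_simp
    ring
  rw [gaussF]
  split_ifs with h
  · rw [pfaff_transformation hc h (by rw [Complex.ofReal_re]; linarith), h1, h2]
  · rw [h1, h2]

end Hypergeometric

/-! ### Appell's function -/

section Appell

/-- The coefficient `(a)_m (a')_n (b)_m (d + m)_n / ((c)_(m+n) m! n!)` at `q = (m, n)`. For
`d = c - b'` these are the coefficients in the expansion of Appell's function
`F₃(a, a', b, b'; c; 1 - 1/u, 1 - u)` in powers of `1 - 1/u`. -/
noncomputable def appellCoeff {K : Type*} [Field K] (a a' b d c : K) (q : ℕ × ℕ) : K :=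
  hypCoeff a b c q.1 * hypCoeff a' (d + q.1) (c + q.1) q.2

theorem map_appellCoeff {K L : Type*} [Field K] [Field L] (φ : K →+* L) (a a' b d c : K)
    (q : ℕ × ℕ) :
    φ (appellCoeff a a' b d c q) = appellCoeff (φ a) (φ a') (φ b) (φ d) (φ c) q := by
  simp only [appellCoeff, map_mul, map_hypCoeff, map_add, map_natCast]

theorem appellCoeff_mul_poch_div_poch {K : Type*} [Field K] {c : K} {q : ℕ × ℕ}
    (hc : poch c (q.1 + q.2) ≠ 0) (a a' b d g : K) :
    appellCoeff a a' b d c q * (poch c (q.1 + q.2) / poch g (q.1 + q.2)) =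
      appellCoeff a a' b d g q := by
  rw [poch_add, mul_ne_zero_iff] at hc
  obtain ⟨h1, h2⟩ := hc
  simp only [appellCoeff, hypCoeff, poch_add]
  field_simp

theorem norm_appellCoeff_le {c : ℂ} {r : ℝ} (hr : 0 < r) (hc : r ≤ c.re) (a a' b d : ℂ)
    (q : ℕ × ℕ) :
    ‖appellCoeff a a' b d c q‖ ≤ appellCoeff ‖a‖ ‖a'‖ ‖b‖ ‖d‖ r q := by
  have hd : ‖d + q.1‖ ≤ ‖d‖ + q.1 := (norm_add_le _ _).trans_eq (by rw [Complex.norm_natCast])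
  have hcm : r + q.1 ≤ (c + q.1).re := by rw [Complex.add_re, Complex.natCast_re]; linarith
  have h1 := norm_hypCoeff_le (le_refl ‖a‖) (le_refl ‖b‖) hr hc q.1
  have h2 := norm_hypCoeff_le (le_refl ‖a'‖) hd (by positivity) hcm q.2
  rw [appellCoeff, appellCoeff, norm_mul]
  exact mul_le_mul h1 h2 (norm_nonneg _) ((norm_nonneg _).trans h1)

theorem appellF3_one_sub_ofReal {c : ℂ} (hc : 0 < c.re) (a a' b b' : ℂ) {u : ℝ} (hu : 1 < u) :
    appellF3 a a' b b' c ((1 - 1 / u : ℝ) : ℂ) ((1 - u : ℝ) : ℂ) =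
      (u : ℂ) ^ (-a') * ∑' m : ℕ, ∑' n : ℕ,
        appellCoeff a a' b (c - b') c (m, n) * ((1 - 1 / u : ℝ) : ℂ) ^ (m + n) := by
  rw [appellF3, ← tsum_mul_left]
  refine tsum_congr fun m => ?_
  have hcm : 0 < (c + m).re := by rw [Complex.add_re, Complex.natCast_re]; positivity
  rw [gaussF_one_sub_ofReal hcm a' b' hu, ordinaryHypergeometric_eq_tsum_hypCoeff,
    add_sub_right_comm, mul_left_comm, ← tsum_mul_left]
  congr 1
  refine tsum_congr fun n => ?_
  simp only [appellCoeff, hypCoeff, poch, pow_add]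
  ring

theorem hasSum_appellCoeff_row {a' d g : ℂ} (hs : ‖a'‖ + ‖d‖ < g.re) (a b : ℂ) (m : ℕ) :
    HasSum (fun n => appellCoeff a a' b d g (m, n))
      (Complex.Gamma g * Complex.Gamma (g - a' - d) /
        (Complex.Gamma (g - a') * Complex.Gamma (g - d)) * hypCoeff a b (g - a') m) := by
  have ha' := Complex.re_le_norm a'
  have hd := Complex.re_le_norm d
  have hg : 0 < g.re := by linarith [norm_nonneg a', norm_nonneg d]
  have hga : 0 < (g - a').re := by rw [Complex.sub_re]; linarith [norm_nonneg d]
  have h := (hasSum_hypCoeff (a := a') (b := d + m) (c := g + m)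
    (by rw [Complex.add_re, Complex.natCast_re]; positivity)
    (by simp only [Complex.add_re, Complex.natCast_re]; linarith)).mul_left (hypCoeff a b g m)
  convert! h using 1
  rw [show g + m - a' - (d + m) = g - a' - d by ring, add_sub_add_right_eq_sub,
    add_sub_right_comm, Gamma_add_natCast hg, Gamma_add_natCast hga, hypCoeff, hypCoeff]
  have := poch_ne_zero_of_re_pos hg m
  field_simp

theorem summable_appellCoeff_norm {a a' b d : ℂ} {r : ℝ} (hs : ‖a‖ + ‖a'‖ + ‖b‖ + ‖d‖ < r) :
    Summable (appellCoeff ‖a‖ ‖a'‖ ‖b‖ ‖d‖ r) := by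
  have hr : 0 < r := hs.trans_le' (by positivity)
  have hra : ‖a‖ + ‖b‖ < r - ‖a'‖ := by linarith [norm_nonneg d]
  have hra' : 0 < r - ‖a'‖ := hra.trans_le' (by positivity)
  have hcol := (summable_norm_hypCoeff (a := ‖a‖) (b := ‖b‖) (c := r - ‖a'‖)
    (by exact_mod_cast hra') (by exact_mod_cast hra)).of_norm
  have hrow := hasSum_appellCoeff_row (a' := ‖a'‖) (d := ‖d‖) (g := r) (by
    simp only [Complex.norm_real, norm_norm, Complex.ofReal_re]
    linarith [norm_nonneg a, norm_nonneg b]) ‖a‖ ‖b‖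
  have hcast : ∀ q : ℕ × ℕ, ((appellCoeff ‖a‖ ‖a'‖ ‖b‖ ‖d‖ r q : ℝ) : ℂ) =
      appellCoeff (‖a‖ : ℂ) ‖a'‖ ‖b‖ ‖d‖ r q := fun q =>
    map_appellCoeff Complex.ofRealHom _ _ _ _ _ q
  simp only [← hcast] at hrow
  refine summable_of_nonneg_of_hasSum_ofReal_row (fun q => ?_) hrow (hcol.mul_left _)
  exact (norm_nonneg _).trans (norm_appellCoeff_le (c := r) hr le_rfl a a' b d q)

theorem hasSum_appellCoeff {a a' b d g : ℂ} (hs : ‖a‖ + ‖a'‖ + ‖b‖ + ‖d‖ < g.re) :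
    HasSum (appellCoeff a a' b d g)
      (Complex.Gamma g * Complex.Gamma (g - a' - d) * Complex.Gamma (g - a' - a - b) /
        (Complex.Gamma (g - d) * Complex.Gamma (g - a' - a) * Complex.Gamma (g - a' - b))) := by
  have hg : 0 < g.re := hs.trans_le' (by positivity)
  have ha := Complex.re_le_norm a
  have ha' := Complex.re_le_norm a'
  have hb := Complex.re_le_norm b
  have hga : 0 < (g - a').re := by
    rw [Complex.sub_re]
    linarith [norm_nonneg a, norm_nonneg b, norm_nonneg d]
  have hΓ := Complex.Gamma_ne_zero_of_re_pos hga
  have hrow := hasSum_appellCoeff_row (a' := a') (d := d) (g := g)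
    (by linarith [norm_nonneg a, norm_nonneg b]) a b
  have hcol := (hasSum_hypCoeff (a := a) (b := b) hga
    (by simp only [Complex.sub_re, Complex.add_re]; linarith [norm_nonneg d])).mul_left
      (Complex.Gamma g * Complex.Gamma (g - a' - d) /
        (Complex.Gamma (g - a') * Complex.Gamma (g - d)))
  have hsum := (Summable.of_norm_bounded (summable_appellCoeff_norm hs)
    (norm_appellCoeff_le hg le_rfl a a' b d)).hasSum
  convert! hsum using 1
  rw [(hsum.prod_fiberwise hrow).unique hcol]
  field_simp

end Appell

/-! ### The kernel of the fractional integral and its moments for large exponents -/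

section Kernel

theorem ae_summable_norm_of_summable_integral_norm {ι X : Type*} [Countable ι]
    {_ : MeasurableSpace X} {ν : Measure X} {F : ι → X → ℂ} (hF : ∀ i, Integrable (F i) ν)
    (hs : Summable fun i => ∫ a, ‖F i a‖ ∂ν) : ∀ᵐ a ∂ν, Summable fun i => ‖F i a‖ := by
  refine summable_norm_of_tsum_eLpNorm_ne_top le_rfl (fun i => (hF i).1) ?_
  simp only [eLpNorm_one_eq_lintegral_enorm, ← ofReal_integral_norm_eq_lintegral_enorm (hF _)]
  exact hs.tsum_ofReal_ne_top

theorem integrable_tsum_of_summable_integral_norm {ι X : Type*} [Countable ι]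
    {_ : MeasurableSpace X} {ν : Measure X} {F : ι → X → ℂ} (hF : ∀ i, Integrable (F i) ν)
    (hs : Summable fun i => ∫ a, ‖F i a‖ ∂ν) : Integrable (fun a => ∑' i, F i a) ν := by
  refine ⟨aestronglyMeasurable_of_tendsto_ae (u := (atTop : Filter (Finset ι)))
    (f := fun s a => ∑ i ∈ s, F i a)
    (fun s => s.aestronglyMeasurable_fun_sum fun i _ => (hF i).1) ?_, ?_⟩
  · filter_upwards [ae_summable_norm_of_summable_integral_norm hF hs] with a ha
    exact ha.of_norm.hasSum
  · refine (lintegral_mono fun a => enorm_tsum_le_tsum_enorm).trans_lt ?_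
    rw [lintegral_tsum fun i => (hF i).1.enorm]
    simp only [← ofReal_integral_norm_eq_lintegral_enorm (hF _)]
    exact hs.tsum_ofReal_ne_top.lt_top

/-- The integrand of the Beta integral `B(c, e)` over `(1, ∞)`, which the substitution `u = 1 / v`
turns into the usual one over `(0, 1)`. -/
noncomputable def betaKernel (c e : ℂ) (u : ℝ) : ℂ :=
  ((u - 1 : ℝ) : ℂ) ^ (c - 1) * (u : ℂ) ^ (-(c + e))

theorem betaKernel_inv {v : ℝ} (hv : v ∈ Ioo (0 : ℝ) 1) (c e : ℂ) :
    |-(v ^ 2)⁻¹| • betaKernel c e v⁻¹ = (v : ℂ) ^ (e - 1) * (1 - (v : ℂ)) ^ (c - 1) := by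
  obtain ⟨hv0, hv1⟩ := hv
  have hvc : (v : ℂ) ≠ 0 := Complex.ofReal_ne_zero.2 hv0.ne'
  have hsub : v⁻¹ - 1 = (1 - v) * v⁻¹ := by field_simp
  have harg : (v : ℂ).arg ≠ Real.pi := by
    rw [Complex.arg_ofReal_of_nonneg hv0.le]
    exact Real.pi_pos.ne
  have hsq : (((v ^ 2)⁻¹ : ℝ) : ℂ) = (v : ℂ) ^ (-2 : ℂ) := by
    rw [Complex.cpow_neg]
    norm_cast
  rw [betaKernel, hsub, Complex.ofReal_mul, Complex.mul_cpow_ofReal_nonneg (by linarith)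
    (by positivity), Complex.ofReal_inv, Complex.inv_cpow _ _ harg, Complex.inv_cpow _ _ harg,
    ← Complex.cpow_neg, ← Complex.cpow_neg, abs_neg, abs_of_nonneg (by positivity),
    Complex.real_smul, hsq, show e - 1 = -2 + (-(c - 1)) + -(-(c + e)) by ring,
    Complex.cpow_add _ _ hvc, Complex.cpow_add _ _ hvc, Complex.ofReal_sub, Complex.ofReal_one]
  ring

theorem hasDerivWithinAt_inv_Ioo {v : ℝ} (hv : v ∈ Ioo (0 : ℝ) 1) :
    HasDerivWithinAt (fun v : ℝ => v⁻¹) (-(v ^ 2)⁻¹) (Ioo 0 1) v :=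
  (hasDerivAt_inv hv.1.ne').hasDerivWithinAt

theorem image_inv_Ioo_zero_one : (fun v : ℝ => v⁻¹) '' Ioo 0 1 = Ioi 1 := by
  rw [image_inv_eq_inv, inv_Ioo_0_left one_pos, inv_one]

theorem integrableOn_betaKernel {c e : ℂ} (hc : 0 < c.re) (he : 0 < e.re) :
    IntegrableOn (betaKernel c e) (Ioi 1) := by
  rw [← image_inv_Ioo_zero_one, integrableOn_image_iff_integrableOn_abs_deriv_smul
    measurableSet_Ioo (fun v => hasDerivWithinAt_inv_Ioo) inv_injective.injOn,
    integrableOn_congr_fun (fun v hv => betaKernel_inv hv c e) measurableSet_Ioo,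
    ← integrableOn_Ioc_iff_integrableOn_Ioo,
    ← intervalIntegrable_iff_integrableOn_Ioc_of_le zero_le_one]
  exact Complex.betaIntegral_convergent he hc

theorem integral_betaKernel {c e : ℂ} (hc : 0 < c.re) (he : 0 < e.re) :
    ∫ u in Ioi 1, betaKernel c e u =
      Complex.Gamma c * Complex.Gamma e / Complex.Gamma (c + e) := by
  rw [← image_inv_Ioo_zero_one, integral_image_eq_integral_abs_deriv_smul
    measurableSet_Ioo (fun v => hasDerivWithinAt_inv_Ioo) inv_injective.injOn,
    setIntegral_congr_fun measurableSet_Ioo (fun v hv => betaKernel_inv hv c e),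
    ← integral_Ioc_eq_integral_Ioo, ← intervalIntegral.integral_of_le zero_le_one,
    ← Complex.betaIntegral, Complex.betaIntegral_eq_Gamma_mul_div e c he hc, add_comm e,
    mul_comm (Complex.Gamma e)]

theorem integral_betaKernel_add_natCast {c e : ℂ} (hc : 0 < c.re) (he : 0 < e.re) (N : ℕ) :
    ∫ u in Ioi 1, betaKernel (c + N) e u =
      (∫ u in Ioi 1, betaKernel c e u) * (poch c N / poch (c + e) N) := by
  rw [integral_betaKernel hc he, integral_betaKernel
    (by rw [Complex.add_re, Complex.natCast_re]; positivity) he, add_right_comm,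
    Gamma_add_natCast hc, Gamma_add_natCast (by rw [Complex.add_re]; positivity)]
  ring

theorem ofReal_norm_betaKernel (c e : ℂ) {u : ℝ} (hu : 1 < u) :
    ((‖betaKernel c e u‖ : ℝ) : ℂ) = betaKernel c.re e.re u := by
  have h1 : 0 < u - 1 := by linarith
  have h2 : 0 < u := by linarith
  rw [betaKernel, betaKernel, norm_mul, Complex.norm_cpow_eq_rpow_re_of_pos h1,
    Complex.norm_cpow_eq_rpow_re_of_pos h2, Complex.ofReal_mul, Complex.ofReal_cpow h1.le,
    Complex.ofReal_cpow h2.le]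
  simp

theorem integral_norm_betaKernel_add_natCast {c e : ℂ} (hc : 0 < c.re) (he : 0 < e.re) (N : ℕ) :
    ∫ u in Ioi 1, ‖betaKernel (c + N) e u‖ =
      (∫ u in Ioi 1, ‖betaKernel c e u‖) * (poch c.re N / poch (c.re + e.re) N) := by
  have hcast : ∀ z : ℂ, ((∫ u in Ioi 1, ‖betaKernel z e u‖ : ℝ) : ℂ) =
      ∫ u in Ioi 1, betaKernel z.re e.re u := fun z => by
    rw [← integral_complex_ofReal]
    exact setIntegral_congr_fun measurableSet_Ioi fun u hu => ofReal_norm_betaKernel z e hu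
  have h := integral_betaKernel_add_natCast (c := c.re) (e := e.re) (by simpa) (by simpa) N
  have hre : (((c + N).re : ℝ) : ℂ) = c.re + N := by simp
  rw [← hre, ← hcast, ← hcast] at h
  have hpoch : ∀ r : ℝ, poch (r : ℂ) N = (poch r N : ℝ) := fun r =>
    (map_poch Complex.ofRealHom r N).symm
  rw [← Complex.ofReal_add, hpoch, hpoch] at h
  exact_mod_cast h

theorem betaKernel_add_natCast (c e : ℂ) (N : ℕ) {u : ℝ} (hu : 1 < u) :
    betaKernel (c + N) e u = betaKernel c e u * ((1 - 1 / u : ℝ) : ℂ) ^ N := by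
  have h1 : ((u - 1 : ℝ) : ℂ) ≠ 0 := Complex.ofReal_ne_zero.2 (by linarith)
  have h2 : (u : ℂ) ≠ 0 := Complex.ofReal_ne_zero.2 (by linarith)
  have h3 : ((1 - 1 / u : ℝ) : ℂ) = ((u - 1 : ℝ) : ℂ) / u := by push_cast; field_simp
  rw [betaKernel, betaKernel, h3, show c + N - 1 = c - 1 + N by ring,
    show -(c + N + e) = -(c + e) - N by ring, Complex.cpow_add _ _ h1, Complex.cpow_sub _ _ h2,
    Complex.cpow_natCast, Complex.cpow_natCast, div_pow]
  field_simp

/-- The kernel of the right-sided Marichev–Saigo–Maeda integral: up to a power of `x`, the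
integrand at `t = x u` is `msmKernel a a' b b' c u * f (x u)`. -/
noncomputable def msmKernel (a a' b b' c : ℂ) (u : ℝ) : ℂ :=
  ((u - 1 : ℝ) : ℂ) ^ (c - 1) * (u : ℂ) ^ (-a) *
    appellF3 a a' b b' c ((1 - 1 / u : ℝ) : ℂ) ((1 - u : ℝ) : ℂ)

/-- The moment `∫ u in Ioi 1, K u * u ^ (-s)` of a kernel `K` on `(1, ∞)`; for `K = msmKernel …` it
gives the fractional integral of the power `t ^ (-s)`. -/
noncomputable def moment (K : ℝ → ℂ) (s : ℂ) : ℂ := ∫ u in Ioi 1, K u * (u : ℂ) ^ (-s)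

/-- Absolute convergence of the integral defining `moment K s`. -/
def MomentConvergent (K : ℝ → ℂ) (s : ℂ) : Prop :=
  IntegrableOn (fun u : ℝ => K u * (u : ℂ) ^ (-s)) (Ioi 1)

/-- The terms of the expansion of `msmKernel a a' b b' c u * u ^ (-s)` into Beta integrands, where
`e = s + a + a' - c`. -/
noncomputable def msmKernelTerm (a a' b b' c e : ℂ) (q : ℕ × ℕ) (u : ℝ) : ℂ :=
  appellCoeff a a' b (c - b') c q * betaKernel (c + (q.1 + q.2 : ℕ)) e u

theorem msmKernel_mul_cpow {c : ℂ} (hc : 0 < c.re) (a a' b b' s : ℂ) {u : ℝ} (hu : 1 < u) :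
    msmKernel a a' b b' c u * (u : ℂ) ^ (-s) =
      ∑' m : ℕ, ∑' n : ℕ, msmKernelTerm a a' b b' c (s + a + a' - c) (m, n) u := by
  have h2 : (u : ℂ) ≠ 0 := Complex.ofReal_ne_zero.2 (by linarith)
  have h3 : betaKernel c (s + a + a' - c) u = ((u - 1 : ℝ) : ℂ) ^ (c - 1) * (u : ℂ) ^ (-a) *
      (u : ℂ) ^ (-a') * (u : ℂ) ^ (-s) := by
    rw [betaKernel, show -(c + (s + a + a' - c)) = -a + -a' + -s by ring,
      Complex.cpow_add _ _ h2, Complex.cpow_add _ _ h2]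
    ring
  simp only [msmKernelTerm, betaKernel_add_natCast _ _ _ hu,
    ← mul_left_comm (betaKernel c (s + a + a' - c) u), tsum_mul_left]
  rw [msmKernel, appellF3_one_sub_ofReal hc a a' b b' hu, h3]
  ring

theorem integrableOn_msmKernelTerm {c e : ℂ} (hc : 0 < c.re) (he : 0 < e.re) (a a' b b' : ℂ)
    (q : ℕ × ℕ) : IntegrableOn (msmKernelTerm a a' b b' c e q) (Ioi 1) :=
  (integrableOn_betaKernel (by rw [Complex.add_re, Complex.natCast_re]; positivity) he).const_mul _

theorem integral_msmKernelTerm {c e : ℂ} (hc : 0 < c.re) (he : 0 < e.re) (a a' b b' : ℂ)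
    (q : ℕ × ℕ) : ∫ u in Ioi 1, msmKernelTerm a a' b b' c e q u =
      Complex.Gamma c * Complex.Gamma e / Complex.Gamma (c + e) *
        appellCoeff a a' b (c - b') (c + e) q := by
  rw [← appellCoeff_mul_poch_div_poch (poch_ne_zero_of_re_pos hc _)]
  simp only [msmKernelTerm, integral_const_mul]
  rw [integral_betaKernel_add_natCast hc he, integral_betaKernel hc he, mul_left_comm]

theorem summable_integral_norm_msmKernelTerm {a a' b b' c e : ℂ} (hc : 0 < c.re) (he : 0 < e.re)
    (hs : ‖a‖ + ‖a'‖ + ‖b‖ + ‖c - b'‖ < c.re + e.re) :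
    Summable fun q => ∫ u in Ioi 1, ‖msmKernelTerm a a' b b' c e q u‖ := by
  refine ((summable_appellCoeff_norm hs).mul_left
    (∫ u in Ioi 1, ‖betaKernel c e u‖)).of_nonneg_of_le
      (fun q => integral_nonneg fun u => norm_nonneg _) fun q => ?_
  simp only [msmKernelTerm, norm_mul, integral_const_mul]
  rw [integral_norm_betaKernel_add_natCast hc he, mul_left_comm,
    ← appellCoeff_mul_poch_div_poch (poch_pos_of_pos hc _).ne']
  have := poch_nonneg hc.le (q.1 + q.2)
  have := poch_nonneg (add_pos hc he).le (q.1 + q.2)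
  gcongr
  exact norm_appellCoeff_le hc le_rfl a a' b (c - b') q

theorem tsum_msmKernelTerm_ae_eq {a a' b b' c s : ℂ} (hc : 0 < c.re)
    (he : 0 < (s + a + a' - c).re)
    (hs : ‖a‖ + ‖a'‖ + ‖b‖ + ‖c - b'‖ < c.re + (s + a + a' - c).re) :
    (fun u => ∑' q, msmKernelTerm a a' b b' c (s + a + a' - c) q u)
      =ᵐ[volume.restrict (Ioi 1)] fun u => msmKernel a a' b b' c u * (u : ℂ) ^ (-s) := by
  filter_upwards [ae_summable_norm_of_summable_integral_norm
    (integrableOn_msmKernelTerm hc he a a' b b') (summable_integral_norm_msmKernelTerm hc he hs),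
    ae_restrict_mem measurableSet_Ioi] with u hsum hu
  rw [hsum.of_norm.tsum_prod, msmKernel_mul_cpow hc a a' b b' s hu]

theorem momentConvergent_msmKernel {a a' b b' c s : ℂ} (hc : 0 < c.re)
    (he : 0 < (s + a + a' - c).re)
    (hs : ‖a‖ + ‖a'‖ + ‖b‖ + ‖c - b'‖ < c.re + (s + a + a' - c).re) :
    MomentConvergent (msmKernel a a' b b' c) s :=
  (integrable_tsum_of_summable_integral_norm (integrableOn_msmKernelTerm hc he a a' b b')
    (summable_integral_norm_msmKernelTerm hc he hs)).congr (tsum_msmKernelTerm_ae_eq hc he hs)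

theorem moment_msmKernel_of_large {a a' b b' c s : ℂ} (hc : 0 < c.re)
    (he : 0 < (s + a + a' - c).re)
    (hs : ‖a‖ + ‖a'‖ + ‖b‖ + ‖c - b'‖ < c.re + (s + a + a' - c).re) :
    moment (msmKernel a a' b b' c) s = Complex.Gamma c * Complex.Gamma (s + a + a' - c) *
      Complex.Gamma (s + a + b' - c) * Complex.Gamma (s - b) /
        (Complex.Gamma s * Complex.Gamma (s + a - b) * Complex.Gamma (s + a + a' + b' - c)) := by
  have hsum := hasSum_integral_of_summable_integral_norm
    (integrableOn_msmKernelTerm hc he a a' b b') (summable_integral_norm_msmKernelTerm hc he hs)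
  rw [integral_congr_ae (tsum_msmKernelTerm_ae_eq hc he hs)] at hsum
  simp only [integral_msmKernelTerm hc he] at hsum
  have hΓ : Complex.Gamma (c + (s + a + a' - c)) ≠ 0 :=
    Complex.Gamma_ne_zero_of_re_pos (by rw [Complex.add_re]; positivity)
  rw [moment, hsum.unique ((hasSum_appellCoeff (by rwa [Complex.add_re c])).mul_left _)]
  rw [add_sub_cancel] at hΓ ⊢
  rw [show s + a + a' - a' - (c - b') = s + a + b' - c by ring,
    show s + a + a' - a' - a - b = s - b by ring,
    show s + a + a' - (c - b') = s + a + a' + b' - c by ring,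
    show s + a + a' - a' - a = s by ring, show s + a + a' - a' - b = s + a - b by ring]
  field_simp

end Kernel

/-! ### Moments as analytic functions of the exponent -/

section Moment

variable {K : ℝ → ℂ} {s s₀ : ℂ}

theorem norm_ofReal_cpow_neg_le_one {u : ℝ} (hu : 1 < u) {w : ℂ} (hw : 0 ≤ w.re) :
    ‖(u : ℂ) ^ (-w)‖ ≤ 1 := by
  rw [Complex.norm_cpow_eq_rpow_re_of_pos (by linarith), Complex.neg_re]
  exact Real.rpow_le_one_of_one_le_of_nonpos hu.le (by linarith)

theorem mul_cpow_neg_eq (K : ℝ → ℂ) {u : ℝ} (hu : 1 < u) (s s₀ : ℂ) :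
    K u * (u : ℂ) ^ (-s) = K u * (u : ℂ) ^ (-s₀) * (u : ℂ) ^ (-(s - s₀)) := by
  rw [mul_assoc, ← Complex.cpow_add _ _ (Complex.ofReal_ne_zero.2 (by linarith))]
  ring_nf

theorem norm_mul_cpow_neg_le (K : ℝ → ℂ) {u : ℝ} (hu : 1 < u) (h : s₀.re ≤ s.re) :
    ‖K u * (u : ℂ) ^ (-s)‖ ≤ ‖K u * (u : ℂ) ^ (-s₀)‖ := by
  rw [mul_cpow_neg_eq K hu s s₀, norm_mul _ ((u : ℂ) ^ (-(s - s₀)))]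
  exact mul_le_of_le_one_right (norm_nonneg _)
    (norm_ofReal_cpow_neg_le_one hu (by rwa [Complex.sub_re, sub_nonneg]))

theorem MomentConvergent.aestronglyMeasurable (hK : MomentConvergent K s₀) (s : ℂ) :
    AEStronglyMeasurable (fun u : ℝ => K u * (u : ℂ) ^ (-s)) (volume.restrict (Ioi 1)) := by
  have hpow : Measurable fun u : ℝ => (u : ℂ) ^ (-(s - s₀)) := by fun_prop
  refine (hK.1.mul hpow.aestronglyMeasurable).congr ?_
  filter_upwards [ae_restrict_mem measurableSet_Ioi] with u hu
  exact (mul_cpow_neg_eq K hu s s₀).symm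

theorem MomentConvergent.of_re_le (hK : MomentConvergent K s₀) (h : s₀.re ≤ s.re) :
    MomentConvergent K s := by
  refine Integrable.mono hK (hK.aestronglyMeasurable s) ?_
  filter_upwards [ae_restrict_mem measurableSet_Ioi] with u hu
  exact norm_mul_cpow_neg_le K hu h

theorem MomentConvergent.integral_norm_le (hK : MomentConvergent K s₀) (h : s₀.re ≤ s.re) :
    ∫ u in Ioi (1 : ℝ), ‖K u * (u : ℂ) ^ (-s)‖ ≤ ∫ u in Ioi (1 : ℝ), ‖K u * (u : ℂ) ^ (-s₀)‖ :=
  setIntegral_mono_on (hK.of_re_le h).norm hK.norm measurableSet_Ioi fun _ hu =>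
    norm_mul_cpow_neg_le K hu h

theorem norm_mul_cpow_neg_mul_log_le (K : ℝ → ℂ) {u δ : ℝ} (hu : 1 < u) (hδ : 0 < δ)
    (h : s₀.re + δ ≤ s.re) :
    ‖K u * (u : ℂ) ^ (-s) * -(Real.log u : ℂ)‖ ≤ ‖K u * (u : ℂ) ^ (-s₀)‖ * (1 / δ) := by
  have hu0 : 0 < u := by linarith
  have hlog := Real.log_nonneg hu.le
  have hshift : ‖K u * (u : ℂ) ^ (-(s₀ + δ))‖ = ‖K u * (u : ℂ) ^ (-s₀)‖ * u ^ (-δ) := by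
    rw [mul_cpow_neg_eq K hu (s₀ + δ) s₀, norm_mul _ ((u : ℂ) ^ (-(s₀ + δ - s₀))),
      Complex.norm_cpow_eq_rpow_re_of_pos hu0, add_sub_cancel_left, Complex.neg_re,
      Complex.ofReal_re]
  have : 0 < u ^ δ := Real.rpow_pos_of_pos hu0 δ
  rw [norm_mul, norm_neg, Complex.norm_real, Real.norm_of_nonneg hlog]
  calc ‖K u * (u : ℂ) ^ (-s)‖ * Real.log u
      ≤ ‖K u * (u : ℂ) ^ (-(s₀ + δ))‖ * (u ^ δ / δ) := by
        gcongr ?_ * ?_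
        · exact norm_mul_cpow_neg_le K hu (by rwa [Complex.add_re, Complex.ofReal_re])
        · exact Real.log_le_rpow_div hu0.le hδ
    _ = ‖K u * (u : ℂ) ^ (-s₀)‖ * (1 / δ) := by
        rw [hshift, Real.rpow_neg hu0.le]
        field_simp

theorem MomentConvergent.differentiableAt_moment (hK : MomentConvergent K s₀)
    (h : s₀.re < s.re) : DifferentiableAt ℂ (moment K) s := by
  obtain ⟨δ, hδ0, hδ⟩ : ∃ δ > 0, s₀.re + 2 * δ = s.re :=
    ⟨(s.re - s₀.re) / 2, by linarith, by ring⟩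
  have hre : ∀ z ∈ Metric.ball s δ, s₀.re + δ ≤ z.re := fun z hz => by
    have hz : |(z - s).re| < δ := (Complex.abs_re_le_norm _).trans_lt (mem_ball_iff_norm.1 hz)
    rw [Complex.sub_re] at hz
    linarith [(abs_lt.1 hz).1]
  refine (hasDerivAt_integral_of_dominated_loc_of_deriv_le
    (F' := fun (z : ℂ) (u : ℝ) => K u * (u : ℂ) ^ (-z) * -(Real.log u : ℂ))
    (Metric.ball_mem_nhds s hδ0) (Eventually.of_forall hK.aestronglyMeasurable)
    (hK.of_re_le h.le) ((hK.aestronglyMeasurable s).mul (by fun_prop)) ?_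
    (hK.norm.mul_const (1 / δ)) ?_).2.differentiableAt
  · filter_upwards [ae_restrict_mem measurableSet_Ioi] with u hu z hz
    exact norm_mul_cpow_neg_mul_log_le K hu hδ0 (hre z hz)
  · filter_upwards [ae_restrict_mem measurableSet_Ioi] with u hu z _
    have hu0 : 0 < u := one_pos.trans hu
    have hderiv := ((hasDerivAt_neg z).const_cpow (c := (u : ℂ))
      (Or.inl (Complex.ofReal_ne_zero.2 hu0.ne'))).const_mul (K u)
    rw [← Complex.ofReal_log hu0.le] at hderiv
    exact hderiv.congr_deriv (by ring)

theorem MomentConvergent.tendsto_moment {ι : Type*} {l : Filter ι} [l.IsCountablyGenerated]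
    {w : ι → ℂ} (hK : MomentConvergent K s₀) (hre : ∀ᶠ i in l, s₀.re ≤ (w i).re)
    {g : ℝ → ℂ} (hlim : ∀ u : ℝ, 1 < u → Tendsto (fun i => (u : ℂ) ^ (-w i)) l (𝓝 (g u))) :
    Tendsto (fun i => moment K (w i)) l (𝓝 (∫ u in Ioi 1, K u * g u)) := by
  refine tendsto_integral_filter_of_dominated_convergence _
    (Eventually.of_forall fun i => hK.aestronglyMeasurable (w i)) ?_ hK.norm ?_
  · filter_upwards [hre] with i hi
    filter_upwards [ae_restrict_mem measurableSet_Ioi] with u hu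
    exact norm_mul_cpow_neg_le K hu hi
  · filter_upwards [ae_restrict_mem measurableSet_Ioi] with u hu
    exact (hlim u hu).const_mul (K u)

theorem MomentConvergent.tendsto_moment_add (hK : MomentConvergent K s₀) :
    Tendsto (fun ε : ℝ => moment K (s₀ + ε)) (𝓝[>] 0) (𝓝 (moment K s₀)) := by
  refine hK.tendsto_moment ?_ fun u hu => ?_
  · filter_upwards [self_mem_nhdsWithin] with ε (hε : 0 < ε)
    rw [Complex.add_re, Complex.ofReal_re]
    linarith
  · have hcont : Continuous fun ε : ℝ => (u : ℂ) ^ (-(s₀ + ε)) :=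
      Continuous.const_cpow (by fun_prop) (Or.inl (Complex.ofReal_ne_zero.2 (one_pos.trans hu).ne'))
    simpa only [Complex.ofReal_zero, add_zero] using
      (hcont.tendsto 0).mono_left (nhdsWithin_le_nhds (s := Ioi 0))

theorem MomentConvergent.tendsto_moment_zero (hK : MomentConvergent K s₀) :
    Tendsto (moment K) (comap Complex.re atTop) (𝓝 0) := by
  suffices hpow : ∀ u : ℝ, 1 < u →
      Tendsto (fun s : ℂ => (u : ℂ) ^ (-s)) (comap Complex.re atTop) (𝓝 0) by
    simpa only [mul_zero, integral_zero] using
      hK.tendsto_moment (tendsto_comap.eventually (eventually_ge_atTop s₀.re)) hpow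
  intro u hu
  have hu0 : 0 < u := one_pos.trans hu
  rw [tendsto_zero_iff_norm_tendsto_zero]
  refine ((tendsto_rpow_atTop_of_base_lt_one u⁻¹ (by linarith [inv_pos.2 hu0])
    (inv_lt_one_of_one_lt₀ hu)).comp tendsto_comap).congr fun s => ?_
  rw [Complex.norm_cpow_eq_rpow_re_of_pos hu0, Complex.neg_re, Function.comp_apply,
    Real.inv_rpow hu0.le, Real.rpow_neg hu0.le]

theorem MomentConvergent.moment_mul_eq {M R : ℂ → ℂ} (hK : MomentConvergent K s₀)
    (hM : Differentiable ℂ M) (hR : Differentiable ℂ R)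
    (h : ∀ᶠ s in comap Complex.re atTop, moment K s * M s = R s) :
    moment K s₀ * M s₀ = R s₀ := by
  obtain ⟨T, -, hT⟩ := (atTop_basis_Ioi.comap Complex.re).eventually_iff.1 h
  have hopen : ∀ r : ℝ, IsOpen {s : ℂ | r < s.re} := fun r =>
    isOpen_lt continuous_const Complex.continuous_re
  have hL : DifferentiableOn ℂ (fun s => moment K s * M s) {s | s₀.re < s.re} :=
    DifferentiableOn.mul (fun s hs => (hK.differentiableAt_moment hs).differentiableWithinAt)
      hM.differentiableOn
  obtain ⟨r, hr₀, hrT⟩ : ∃ r : ℝ, s₀.re < r ∧ T < r :=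
    ⟨max s₀.re T + 1, by linarith [le_max_left s₀.re T], by linarith [le_max_right s₀.re T]⟩
  have heq : EqOn (fun s => moment K s * M s) R {s | s₀.re < s.re} :=
    (hL.analyticOnNhd (hopen _)).eqOn_of_preconnected_of_eventuallyEq
      (hR.differentiableOn.analyticOnNhd (hopen _)) (convex_halfSpace_re_gt _).isPreconnected
      (z₀ := (r : ℂ)) hr₀ (eventually_of_mem ((hopen T).mem_nhds hrT) fun s hs => hT hs)
  have hpath : Tendsto (fun ε : ℝ => s₀ + (ε : ℂ)) (𝓝[>] 0) (𝓝 s₀) := by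
    have hcont : Continuous fun ε : ℝ => s₀ + (ε : ℂ) := by fun_prop
    simpa only [Complex.ofReal_zero, add_zero] using
      (hcont.tendsto 0).mono_left (nhdsWithin_le_nhds (s := Ioi 0))
  refine tendsto_nhds_unique
    (hK.tendsto_moment_add.mul ((hM.continuous.tendsto s₀).comp hpath))
    (((hR.continuous.tendsto s₀).comp hpath).congr' ?_)
  filter_upwards [self_mem_nhdsWithin] with ε (hε : 0 < ε)
  exact (heq (show s₀.re < (s₀ + (ε : ℂ)).re by
    rw [Complex.add_re, Complex.ofReal_re]; linarith)).symm

theorem MomentConvergent.of_isBigO {f : ℝ → ℂ} (hK : MomentConvergent K s₀)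
    (hf : IntegrableOn (fun u => K u * f u) (Ioi 1))
    (hO : (fun u : ℝ => (u : ℂ) ^ (-s)) =O[atTop] f) : MomentConvergent K s := by
  obtain ⟨C, hC⟩ := hO.bound
  obtain ⟨R, hR⟩ := eventually_atTop.1 hC
  refine Integrable.mono' ((hK.norm.const_mul (R ^ |(s - s₀).re|)).abs.add (hf.norm.const_mul |C|))
    (hK.aestronglyMeasurable s) ?_
  filter_upwards [ae_restrict_mem measurableSet_Ioi] with u (hu : 1 < u)
  have hu0 : 0 < u := one_pos.trans hu
  simp only [Pi.add_apply]
  rcases le_total R u with h | h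
  · calc ‖K u * (u : ℂ) ^ (-s)‖ ≤ ‖K u‖ * (C * ‖f u‖) := by
          rw [norm_mul]; gcongr; exact hR u h
      _ ≤ ‖K u‖ * (|C| * ‖f u‖) := by gcongr; exact le_abs_self C
      _ = |C| * ‖K u * f u‖ := by rw [norm_mul]; ring
      _ ≤ _ := le_add_of_nonneg_left (abs_nonneg _)
  · have hpow : ‖(u : ℂ) ^ (-(s - s₀))‖ ≤ R ^ |(s - s₀).re| := by
      rw [Complex.norm_cpow_eq_rpow_re_of_pos hu0, Complex.neg_re]
      exact (Real.rpow_le_rpow_of_exponent_le hu.le (neg_le_abs _)).trans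
        (Real.rpow_le_rpow hu0.le h (abs_nonneg _))
    calc ‖K u * (u : ℂ) ^ (-s)‖
        = ‖(u : ℂ) ^ (-(s - s₀))‖ * ‖K u * (u : ℂ) ^ (-s₀)‖ := by
          rw [mul_cpow_neg_eq K hu s s₀, norm_mul, mul_comm]
      _ ≤ R ^ |(s - s₀).re| * ‖K u * (u : ℂ) ^ (-s₀)‖ := by gcongr
      _ ≤ _ := (le_abs_self _).trans (le_add_of_nonneg_right (by positivity))

end Moment

section GammaQuotient

theorem eventually_comap_re_lt_add (r : ℝ) (w : ℂ) :
    ∀ᶠ s in comap Complex.re atTop, r < (s + w).re := by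
  filter_upwards [tendsto_comap.eventually (eventually_gt_atTop (r - w.re))] with s hs
  rw [Complex.add_re]
  linarith

theorem eventually_comap_re_Gamma_add_ne_zero (w : ℂ) :
    ∀ᶠ s in comap Complex.re atTop, Complex.Gamma (s + w) ≠ 0 :=
  (eventually_comap_re_lt_add 0 w).mono fun _ => Complex.Gamma_ne_zero_of_re_pos

theorem eventually_norm_lt_re_add {c : ℂ} (hc : 0 < c.re) (a a' b b' : ℂ) :
    ∀ᶠ s in comap Complex.re atTop, 0 < (s + a + a' - c).re ∧
      ‖a‖ + ‖a'‖ + ‖b‖ + ‖c - b'‖ < c.re + (s + a + a' - c).re := by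
  filter_upwards [eventually_comap_re_lt_add (‖a‖ + ‖a'‖ + ‖b‖ + ‖c - b'‖) (a + a' - c)] with s hs
  rw [← add_sub_assoc, ← add_assoc] at hs
  exact ⟨lt_of_le_of_lt (by positivity) hs, by linarith⟩

theorem exists_momentConvergent_msmKernel {c : ℂ} (hc : 0 < c.re) (a a' b b' : ℂ) :
    ∃ s, MomentConvergent (msmKernel a a' b b' c) s := by
  have : (comap Complex.re atTop).NeBot :=
    atTop_neBot.comap_of_surj fun r => ⟨r, Complex.ofReal_re r⟩
  exact (eventually_norm_lt_re_add hc a a' b b').exists.imp fun _ h =>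
    momentConvergent_msmKernel hc h.1 h.2

theorem moment_msmKernel_mul_inv_Gamma {a a' b b' c s : ℂ} (hc : 0 < c.re)
    (hs : MomentConvergent (msmKernel a a' b b' c) s) :
    moment (msmKernel a a' b b' c) s * ((Complex.Gamma (s - b))⁻¹ *
        (Complex.Gamma (s + a + a' - c))⁻¹ * (Complex.Gamma (s + a + b' - c))⁻¹) =
      Complex.Gamma c * ((Complex.Gamma s)⁻¹ * (Complex.Gamma (s + a - b))⁻¹ *
        (Complex.Gamma (s + a + a' + b' - c))⁻¹) := by
  have hΓ : ∀ φ : ℂ → ℂ, Differentiable ℂ φ → Differentiable ℂ fun z => (Complex.Gamma (φ z))⁻¹ :=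
    fun φ hφ => Complex.differentiable_one_div_Gamma.comp hφ
  refine hs.moment_mul_eq
    (M := fun z => (Complex.Gamma (z - b))⁻¹ * (Complex.Gamma (z + a + a' - c))⁻¹ *
      (Complex.Gamma (z + a + b' - c))⁻¹)
    (R := fun z => Complex.Gamma c * ((Complex.Gamma z)⁻¹ * (Complex.Gamma (z + a - b))⁻¹ *
      (Complex.Gamma (z + a + a' + b' - c))⁻¹))
    (((hΓ _ (by fun_prop)).mul (hΓ _ (by fun_prop))).mul (hΓ _ (by fun_prop)))
    ((((hΓ _ (by fun_prop)).mul (hΓ _ (by fun_prop))).mul (hΓ _ (by fun_prop))).const_mul _) ?_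
  filter_upwards [eventually_norm_lt_re_add hc a a' b b',
    eventually_comap_re_Gamma_add_ne_zero (-b),
    eventually_comap_re_Gamma_add_ne_zero (a + a' - c),
    eventually_comap_re_Gamma_add_ne_zero (a + b' - c)] with z hz h₁ h₂ h₃
  rw [moment_msmKernel_of_large hc hz.1 hz.2]
  simp only [← add_assoc, ← add_sub_assoc, ← sub_eq_add_neg] at h₁ h₂ h₃
  field_simp

theorem moment_msmKernel_mul_poch {a a' b b' c s : ℂ} {n : ℕ} (hc : 0 < c.re)
    (hs : MomentConvergent (msmKernel a a' b b' c) s) (h₁ : Complex.Gamma (s - b) ≠ 0)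
    (h₂ : Complex.Gamma (s + a + a' - c + n) ≠ 0) (h₃ : Complex.Gamma (s + a + b' - c) ≠ 0) :
    moment (msmKernel a a' b b' c) s * poch (s + a + a' - c) n = Complex.Gamma c *
      (Complex.Gamma (s - b) * Complex.Gamma (s + a + a' - c + n) *
        Complex.Gamma (s + a + b' - c)) /
      (Complex.Gamma s * Complex.Gamma (s + a - b) * Complex.Gamma (s + a + a' + b' - c)) := by
  have h := moment_msmKernel_mul_inv_Gamma hc hs
  rw [inv_Gamma_eq_poch_mul (s + a + a' - c) n] at h
  calc _ = moment (msmKernel a a' b b' c) s * ((Complex.Gamma (s - b))⁻¹ *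
        (poch (s + a + a' - c) n * (Complex.Gamma (s + a + a' - c + n))⁻¹) *
        (Complex.Gamma (s + a + b' - c))⁻¹) * (Complex.Gamma (s - b) *
          Complex.Gamma (s + a + a' - c + n) * Complex.Gamma (s + a + b' - c)) := by field_simp
    _ = _ := by
        rw [h]
        ring

end GammaQuotient

theorem betaKernel_zero_mul_cpow (c e : ℂ) {u : ℝ} (hu : 1 < u) :
    betaKernel c 0 u * (u : ℂ) ^ (-e) = betaKernel c e u := by
  rw [betaKernel, betaKernel, mul_assoc,
    ← Complex.cpow_add _ _ (Complex.ofReal_ne_zero.2 (one_pos.trans hu).ne')]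
  ring_nf

theorem moment_betaKernel_zero {c e : ℂ} (hc : 0 < c.re) (he : 0 < e.re) :
    moment (betaKernel c 0) e = Complex.Gamma c * Complex.Gamma e / Complex.Gamma (c + e) := by
  rw [← integral_betaKernel hc he, moment]
  exact setIntegral_congr_fun measurableSet_Ioi fun u hu => betaKernel_zero_mul_cpow c e hu

theorem momentConvergent_betaKernel_zero {c e : ℂ} (hc : 0 < c.re) (he : 0 < e.re) :
    MomentConvergent (betaKernel c 0) e :=
  (integrableOn_betaKernel hc he).congr_fun
    (fun _ hu => (betaKernel_zero_mul_cpow c e hu).symm) measurableSet_Ioi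

theorem tendsto_Gamma_div_Gamma_add {c : ℂ} (hc : 0 < c.re) :
    Tendsto (fun s => Complex.Gamma s / Complex.Gamma (s + c)) (comap Complex.re atTop) (𝓝 0) := by
  have hlim := (momentConvergent_betaKernel_zero hc (e := 1)
    (Complex.one_re ▸ one_pos)).tendsto_moment_zero.const_mul (Complex.Gamma c)⁻¹
  rw [mul_zero] at hlim
  refine hlim.congr' ?_
  filter_upwards [tendsto_comap.eventually (eventually_gt_atTop 0)] with s hs
  have hΓ := Complex.Gamma_ne_zero_of_re_pos hc
  rw [moment_betaKernel_zero hc hs, add_comm c]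
  field_simp

/-! ### Series in descending powers -/

section DescSeries

/-- The power series with coefficients `E` is entire, stated as absolute convergence at every
radius: the condition under which `descSeries E τ s` converges on the whole of `(0, ∞)`. -/
def EntireCoeff (E : ℕ → ℂ) : Prop := ∀ r : ℝ, 0 ≤ r → Summable fun k => ‖E k‖ * r ^ k

/-- The series `∑ E k * y ^ (-(s + τ * k))` in powers of `y` descending by steps of `τ`, the common
form of the function `f` of the theorem and of its fractional integrals and derivatives. -/
noncomputable def descSeries (E : ℕ → ℂ) (τ : ℝ) (s : ℂ) (y : ℝ) : ℂ :=
  ∑' k : ℕ, E k * (y : ℂ) ^ (-(s + τ * k))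

variable {E : ℕ → ℂ}

theorem EntireCoeff.of_norm_le {F : ℕ → ℂ} (hE : EntireCoeff E) {M : ℝ}
    (h : ∀ k, ‖F k‖ ≤ M * ‖E k‖) : EntireCoeff F := fun r hr =>
  ((hE r hr).mul_left M).of_nonneg_of_le (fun k => by positivity) fun k => by
    rw [← mul_assoc]
    exact mul_le_mul_of_nonneg_right (h k) (by positivity)

theorem EntireCoeff.mul_pow (hE : EntireCoeff E) (w : ℂ) : EntireCoeff fun k => E k * w ^ k :=
  fun r hr => (hE (‖w‖ * r) (by positivity)).congr fun k => by
    rw [norm_mul, norm_pow, _root_.mul_pow, mul_assoc]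

theorem EntireCoeff.comp_add (hE : EntireCoeff E) (m : ℕ) : EntireCoeff fun k => E (k + m) :=
  fun r hr => by
    have h := (summable_nat_add_iff m).2 (hE (max r 1) (by positivity))
    refine h.of_nonneg_of_le (fun k => by positivity) fun k => ?_
    gcongr
    calc r ^ k ≤ max r 1 ^ k := pow_le_pow_left₀ hr (le_max_left r 1) k
      _ ≤ max r 1 ^ (k + m) := pow_le_pow_right₀ (le_max_right r 1) (k.le_add_right m)

theorem norm_add_mul_natCast_le (w v : ℂ) (k : ℕ) : ‖w + v * k‖ ≤ (‖w‖ + ‖v‖) * ‖(2 : ℂ) ^ k‖ := by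
  have hk : (k : ℝ) ≤ 2 ^ k := by exact_mod_cast k.lt_two_pow_self.le
  have hone : (1 : ℝ) ≤ 2 ^ k := one_le_pow₀ one_le_two
  rw [norm_pow, Complex.norm_ofNat]
  calc ‖w + v * k‖ ≤ ‖w‖ + ‖v‖ * k := (norm_add_le _ _).trans_eq (by simp)
    _ ≤ ‖w‖ * 2 ^ k + ‖v‖ * 2 ^ k := by
        gcongr
        exact le_mul_of_one_le_right (norm_nonneg w) hone
    _ = (‖w‖ + ‖v‖) * 2 ^ k := by ring

theorem EntireCoeff.mul_linear (hE : EntireCoeff E) (w v : ℂ) :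
    EntireCoeff fun k => E k * (w + v * k) := by
  refine (hE.mul_pow 2).of_norm_le (M := ‖w‖ + ‖v‖) fun k => ?_
  rw [norm_mul, norm_mul, mul_left_comm]
  exact mul_le_mul_of_nonneg_left (norm_add_mul_natCast_le w v k) (norm_nonneg _)

theorem EntireCoeff.mul_poch (hE : EntireCoeff E) (w v : ℂ) (n : ℕ) :
    EntireCoeff fun k => E k * poch (w + v * k) n := by
  induction n with
  | zero => simpa only [poch_zero, mul_one] using hE
  | succ n ih =>
    convert ih.mul_linear (w + n) v using 2 with k
    rw [poch_succ]
    ring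

variable {τ y : ℝ} {s : ℂ}

theorem norm_cpow_neg_add_mul (hy : 0 < y) (τ : ℝ) (s : ℂ) (k : ℕ) :
    ‖(y : ℂ) ^ (-(s + τ * k))‖ = y ^ (-s.re) * (y ^ (-τ)) ^ k := by
  rw [Complex.norm_cpow_eq_rpow_re_of_pos hy, ← Real.rpow_mul_natCast hy.le, ← Real.rpow_add hy]
  congr 1
  simp only [Complex.neg_re, Complex.add_re, Complex.re_ofReal_mul, Complex.natCast_re]
  ring

theorem EntireCoeff.summable_norm (hE : EntireCoeff E) (τ : ℝ) (s : ℂ) (hy : 0 < y) :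
    Summable fun k : ℕ => ‖E k * (y : ℂ) ^ (-(s + τ * k))‖ := by
  refine ((hE (y ^ (-τ)) (by positivity)).mul_left (y ^ (-s.re))).congr fun k => ?_
  rw [norm_mul, norm_cpow_neg_add_mul hy]
  ring

theorem descSeries_mul_left (w : ℂ) (E : ℕ → ℂ) (τ : ℝ) (s : ℂ) (y : ℝ) :
    w * descSeries E τ s y = descSeries (fun k => w * E k) τ s y := by
  simp only [descSeries, ← tsum_mul_left, mul_assoc]

theorem cpow_mul_descSeries (w : ℂ) (E : ℕ → ℂ) (τ : ℝ) (s : ℂ) (hy : 0 < y) :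
    (y : ℂ) ^ w * descSeries E τ s y = descSeries E τ (s - w) y := by
  rw [descSeries, descSeries, ← tsum_mul_left]
  refine tsum_congr fun k => ?_
  rw [show -(s - w + τ * (k : ℂ)) = w + -(s + τ * k) by ring,
    Complex.cpow_add _ _ (Complex.ofReal_ne_zero.2 hy.ne')]
  ring

theorem hasDerivAt_ofReal_cpow_neg (hy : 0 < y) (w : ℂ) :
    HasDerivAt (fun y : ℝ => (y : ℂ) ^ (-w)) (-w * (y : ℂ) ^ (-(w + 1))) y := by
  have h := ((hasDerivAt_id (y : ℂ)).cpow_const (c := -w) (Or.inl hy)).comp_ofReal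
  rwa [mul_one, ← neg_add'] at h

theorem rpow_le_rpow_add_rpow_of_mem_Ioo {l r z : ℝ} (hl : 0 < l) (hz : z ∈ Ioo l r) (t : ℝ) :
    z ^ t ≤ l ^ t + r ^ t := by
  have hz0 : 0 < z := hl.trans hz.1
  rcases le_total 0 t with ht | ht
  · exact (Real.rpow_le_rpow hz0.le hz.2.le ht).trans (le_add_of_nonneg_left (by positivity))
  · exact (Real.rpow_le_rpow_of_nonpos hl hz.1.le ht).trans
      (le_add_of_nonneg_right (Real.rpow_nonneg (hz0.trans hz.2).le t))

theorem EntireCoeff.hasDerivAt_descSeries (hE : EntireCoeff E) (τ : ℝ) (s : ℂ) (hy : 0 < y) :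
    HasDerivAt (descSeries E τ s)
      (descSeries (fun k => E k * -(s + τ * k)) τ (s + 1) y) y := by
  have hy2 : 0 < y / 2 := half_pos hy
  have hmem : y ∈ Ioo (y / 2) (2 * y) := ⟨by linarith, by linarith⟩
  have hE' : EntireCoeff fun k => E k * -(s + τ * k) := by
    simpa only [neg_add, neg_mul] using hE.mul_linear (-s) (-τ)
  refine hasDerivAt_tsum_of_isPreconnected (g := fun (k : ℕ) (z : ℝ) =>
      E k * (z : ℂ) ^ (-(s + τ * k))) (g' := fun k z =>
      E k * -(s + τ * k) * (z : ℂ) ^ (-(s + 1 + τ * k))) (t := Ioo (y / 2) (2 * y)) (y₀ := y)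
    ((hE' ((y / 2) ^ (-τ) + (2 * y) ^ (-τ)) (by positivity)).mul_left
      ((y / 2) ^ (-(s + 1).re) + (2 * y) ^ (-(s + 1).re))) isOpen_Ioo
    isPreconnected_Ioo (fun k z hz => ?_) (fun k z hz => ?_) hmem (hE.summable_norm τ s hy).of_norm
    hmem
  · have h := (hasDerivAt_ofReal_cpow_neg (hy2.trans hz.1) (s + τ * k)).const_mul (E k)
    rwa [← mul_assoc, add_right_comm] at h
  · have hz0 : 0 < z := hy2.trans hz.1
    rw [norm_mul, norm_cpow_neg_add_mul hz0, mul_left_comm]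
    gcongr
    · exact rpow_le_rpow_add_rpow_of_mem_Ioo hy2 hz _
    · exact rpow_le_rpow_add_rpow_of_mem_Ioo hy2 hz _

theorem EntireCoeff.contDiffOn_descSeries (hE : EntireCoeff E) (τ : ℝ) (s : ℂ) (n : ℕ) :
    ContDiffOn ℝ n (descSeries E τ s) (Ioi 0) := by
  induction n generalizing E s with
  | zero =>
    rw [Nat.cast_zero, contDiffOn_zero]
    exact fun y hy => (hE.hasDerivAt_descSeries τ s hy).continuousAt.continuousWithinAt
  | succ n ih =>
    have hE' : EntireCoeff fun k => E k * -(s + τ * k) := by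
      simpa only [neg_add, neg_mul] using hE.mul_linear (-s) (-τ)
    rw [Nat.cast_succ, contDiffOn_succ_iff_deriv_of_isOpen isOpen_Ioi]
    exact ⟨fun y hy => (hE.hasDerivAt_descSeries τ s hy).differentiableAt.differentiableWithinAt,
      by simp, (ih hE' (s + 1)).congr fun y hy => (hE.hasDerivAt_descSeries τ s hy).deriv⟩

theorem EntireCoeff.iteratedDeriv_descSeries (hE : EntireCoeff E) (τ : ℝ) (s : ℂ) (n : ℕ)
    (hy : 0 < y) : (-1) ^ n * iteratedDeriv n (descSeries E τ s) y =
      descSeries (fun k => E k * poch (s + τ * k) n) τ (s + n) y := by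
  induction n generalizing y with
  | zero => simp
  | succ n ih =>
    have hloc : (fun z => (-1) ^ n * iteratedDeriv n (descSeries E τ s) z) =ᶠ[𝓝 y]
        descSeries (fun k => E k * poch (s + τ * k) n) τ (s + n) := by
      filter_upwards [isOpen_Ioi.mem_nhds hy] with z hz
      exact ih hz
    have hderiv := ((hE.mul_poch s τ n).hasDerivAt_descSeries τ (s + n) hy).deriv
    rw [← hloc.deriv_eq, deriv_const_mul_field] at hderiv
    rw [iteratedDeriv_succ, pow_succ', neg_one_mul, neg_mul, hderiv, neg_eq_neg_one_mul,
      descSeries_mul_left]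
    refine tsum_congr fun k => ?_
    simp only [poch_succ]
    push_cast
    ring_nf

theorem EntireCoeff.tendsto_tsum_mul_rpow_neg (hE : EntireCoeff E) (hτ : 0 < τ) :
    Tendsto (fun t : ℝ => ∑' k : ℕ, E k * ((t ^ (-τ) : ℝ) : ℂ) ^ k) atTop (𝓝 (E 0)) := by
  have hsum : Summable fun k => ‖E k‖ := by
    simpa only [one_pow, mul_one] using hE 1 zero_le_one
  have hlim : Tendsto (fun t : ℝ => ∑' k : ℕ, E k * ((t ^ (-τ) : ℝ) : ℂ) ^ k) atTop
      (𝓝 (∑' k : ℕ, E k * (0 : ℂ) ^ k)) := by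
    refine tendsto_tsum_of_dominated_convergence hsum (fun k => ?_) ?_
    · have h0 : Tendsto (fun t : ℝ => ((t ^ (-τ) : ℝ) : ℂ)) atTop (𝓝 0) :=
        (Complex.continuous_ofReal.tendsto' 0 0 Complex.ofReal_zero).comp
          (tendsto_rpow_neg_atTop hτ)
      exact (h0.pow k).const_mul (E k)
    · filter_upwards [eventually_ge_atTop 1] with t ht k
      rw [norm_mul, norm_pow, Complex.norm_real, Real.norm_of_nonneg (by positivity)]
      exact mul_le_of_le_one_right (norm_nonneg _) (pow_le_one₀ (by positivity)
        (Real.rpow_le_one_of_one_le_of_nonpos ht (neg_nonpos.2 hτ.le)))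
  rwa [tsum_eq_single 0 fun k hk => by rw [zero_pow hk, mul_zero], pow_zero, mul_one] at hlim

theorem EntireCoeff.descSeries_eq_cpow_mul (hE : EntireCoeff E) {k₀ : ℕ}
    (hlt : ∀ k < k₀, E k = 0) (hy : 0 < y) : descSeries E τ s y =
      (y : ℂ) ^ (-(s + τ * k₀)) * ∑' j : ℕ, E (j + k₀) * ((y ^ (-τ) : ℝ) : ℂ) ^ j := by
  rw [descSeries, ← (hE.summable_norm τ s hy).of_norm.sum_add_tsum_nat_add k₀,
    Finset.sum_eq_zero fun k hk => by rw [hlt k (Finset.mem_range.1 hk), zero_mul], zero_add,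
    ← tsum_mul_left]
  refine tsum_congr fun j => ?_
  rw [Complex.ofReal_cpow hy.le, ← Complex.cpow_mul_nat, mul_left_comm,
    ← Complex.cpow_add _ _ (Complex.ofReal_ne_zero.2 hy.ne')]
  push_cast
  ring_nf

theorem EntireCoeff.isBigO_cpow_descSeries (hE : EntireCoeff E) (hτ : 0 < τ) (s : ℂ) {k₀ : ℕ}
    (h₀ : E k₀ ≠ 0) (hlt : ∀ k < k₀, E k = 0) :
    (fun t : ℝ => (t : ℂ) ^ (-(s + τ * k₀))) =O[atTop] descSeries E τ s := by
  have hlim := ((hE.comp_add k₀).tendsto_tsum_mul_rpow_neg hτ).norm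
  rw [zero_add] at hlim
  have hnorm : 0 < ‖E k₀‖ := norm_pos_iff.2 h₀
  have hone := (Asymptotics.isBigO_const_left_iff_pos_le_norm (one_ne_zero (α := ℂ))).2
    ⟨_, half_pos hnorm, hlim.eventually_const_le (half_lt_self hnorm)⟩
  refine ((Asymptotics.isBigO_refl (fun t : ℝ => (t : ℂ) ^ (-(s + τ * k₀))) atTop).mul
    hone).congr' (Eventually.of_forall fun t => mul_one _) ?_
  filter_upwards [eventually_gt_atTop 0] with t ht
  exact (hE.descSeries_eq_cpow_mul hlt ht).symm

end DescSeries

/-! ### The coefficients of the Struve function -/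

section Struve

theorem tendsto_comap_re_ofReal_mul_natCast_add {α : ℝ} (hα : 0 < α) (μ : ℂ) :
    Tendsto (fun k : ℕ => (α : ℂ) * k + μ) atTop (comap Complex.re atTop) := by
  refine tendsto_comap_iff.2 ?_
  simpa only [Function.comp_def, Complex.add_re, Complex.re_ofReal_mul, Complex.natCast_re] using
    tendsto_atTop_add_const_right _ μ.re (tendsto_natCast_atTop_atTop.const_mul_atTop hα)

theorem entireCoeff_inv_Gamma {α : ℝ} (hα : 0 < α) (μ : ℂ) :
    EntireCoeff fun k : ℕ => (Complex.Gamma (α * k + μ))⁻¹ := by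
  intro r hr
  have hlin := tendsto_comap_re_ofReal_mul_natCast_add hα μ
  have hne : ∀ᶠ k : ℕ in atTop, Complex.Gamma (α * k + μ) ≠ 0 := by
    simpa only [add_zero] using hlin.eventually (eventually_comap_re_Gamma_add_ne_zero 0)
  have hratio : Tendsto (fun k : ℕ => (r + 1) *
      ‖Complex.Gamma (α * k + μ) / Complex.Gamma (α * k + μ + α)‖) atTop (𝓝 0) := by
    simpa only [norm_zero, mul_zero, Function.comp_def] using
      ((tendsto_Gamma_div_Gamma_add (c := α) (by simpa)).comp hlin).norm.const_mul (r + 1)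
  have hr₁ : 0 < r + 1 := by positivity
  have hsum : Summable fun k : ℕ => ‖(Complex.Gamma (α * k + μ))⁻¹‖ * (r + 1) ^ k := by
    refine summable_of_ratio_test_tendsto_lt_one zero_lt_one ?_ (hratio.congr' ?_)
    · filter_upwards [hne] with k hk
      exact mul_ne_zero (norm_ne_zero_iff.2 (inv_ne_zero hk)) (pow_ne_zero _ hr₁.ne')
    · filter_upwards [hne] with k hk
      have hk' := norm_ne_zero_iff.2 hk
      rw [show (α : ℂ) * (k + 1 : ℕ) + μ = α * k + μ + α by push_cast; ring, norm_mul, norm_mul,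
        norm_norm, norm_norm, norm_pow, norm_pow, Real.norm_of_nonneg hr₁.le, norm_div, norm_inv,
        norm_inv, pow_succ]
      field_simp
  refine hsum.of_nonneg_of_le (fun k => by positivity) fun k => ?_
  gcongr
  exact le_add_of_nonneg_right zero_le_one

theorem exists_norm_inv_Gamma_natCast_add_le (ν : ℂ) :
    ∃ M : ℝ, ∀ n : ℕ, ‖(Complex.Gamma (n + ν))⁻¹‖ ≤ M := by
  have h := entireCoeff_inv_Gamma one_pos ν 1 zero_le_one
  simp only [Complex.ofReal_one, one_mul, one_pow, mul_one] at h
  obtain ⟨M, hM⟩ := h.tendsto_atTop_zero.bddAbove_range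
  exact ⟨M, fun n => hM (mem_range_self n)⟩

/-- The coefficient of `z ^ (2 * k + p + 1)` in the generalized Struve function. -/
noncomputable def struveCoeff (a : ℕ) (p b c : ℂ) (η α : ℝ) (μ : ℂ) (k : ℕ) : ℂ :=
  (-c) ^ k / (Complex.Gamma (α * k + μ) * Complex.Gamma (a * k + p / η + (b + 2) / 2)) /
    2 ^ (2 * (k : ℂ) + p + 1)

theorem two_cpow_two_mul_add (p : ℂ) (k : ℕ) :
    (2 : ℂ) ^ (2 * (k : ℂ) + p + 1) = 4 ^ k * 2 ^ (p + 1) := by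
  rw [add_assoc, Complex.cpow_add _ _ two_ne_zero, Complex.cpow_mul_nat, Complex.cpow_ofNat]
  norm_num

theorem entireCoeff_struveCoeff (a : ℕ) (p b c : ℂ) (η : ℝ) {α : ℝ} (hα : 0 < α) (μ : ℂ) :
    EntireCoeff (struveCoeff a p b c η α μ) := by
  obtain ⟨M, hM⟩ := exists_norm_inv_Gamma_natCast_add_le (p / η + (b + 2) / 2)
  refine ((entireCoeff_inv_Gamma hα μ).mul_pow (-c / 4)).of_norm_le
    (M := M * ‖((2 : ℂ) ^ (p + 1))⁻¹‖) fun k => ?_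
  have hk := hM (a * k)
  rw [Nat.cast_mul, ← add_assoc] at hk
  calc ‖struveCoeff a p b c η α μ k‖
      = ‖(Complex.Gamma (a * k + p / η + (b + 2) / 2))⁻¹‖ * ‖((2 : ℂ) ^ (p + 1))⁻¹‖ *
          ‖(Complex.Gamma (α * k + μ))⁻¹ * (-c / 4) ^ k‖ := by
        rw [← norm_mul, ← norm_mul, struveCoeff, two_cpow_two_mul_add, div_pow]
        congr 1
        ring
    _ ≤ M * ‖((2 : ℂ) ^ (p + 1))⁻¹‖ * ‖(Complex.Gamma (α * k + μ))⁻¹ * (-c / 4) ^ k‖ := by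
        gcongr

theorem cpow_mul_genStruve (a : ℕ) (p b c ρ μ : ℂ) (η α : ℝ) {t : ℝ} (ht : 0 < t) :
    (t : ℂ) ^ (-ρ) * genStruve a p b c η α μ (1 / (t : ℂ)) =
      descSeries (struveCoeff a p b c η α μ) 2 (ρ + p + 1) t := by
  have harg (k : ℕ) : (1 / (t : ℂ) / 2) ^ (2 * (k : ℂ) + p + 1) =
      (t : ℂ) ^ (-(2 * (k : ℂ) + p + 1)) / 2 ^ (2 * (k : ℂ) + p + 1) := by
    have h := Complex.div_cpow_ofReal_nonneg (inv_nonneg.2 ht.le) zero_le_two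
      (2 * (k : ℂ) + p + 1)
    rwa [Complex.ofReal_inv, Complex.inv_cpow_ofReal_nonneg ht.le, ← Complex.cpow_neg, ← one_div,
      Complex.ofReal_ofNat] at h
  rw [genStruve, descSeries, ← tsum_mul_left]
  refine tsum_congr fun k => ?_
  rw [harg, struveCoeff, Complex.ofReal_ofNat,
    show -(ρ + p + 1 + 2 * (k : ℂ)) = -ρ + -(2 * (k : ℂ) + p + 1) by ring,
    Complex.cpow_add _ _ (Complex.ofReal_ne_zero.2 ht.ne')]
  ring

end Struve

/-! ### Integrating a series in descending powers against a kernel -/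

section Transform

variable {K : ℝ → ℂ} {D : ℕ → ℂ} {τ x : ℝ} {s s₀ : ℂ}

theorem ofReal_mul_cpow {x u : ℝ} (hx : 0 < x) (hu : 1 < u) (w : ℂ) :
    ((x * u : ℝ) : ℂ) ^ w = (x : ℂ) ^ w * (u : ℂ) ^ w := by
  rw [Complex.ofReal_mul, Complex.mul_cpow_ofReal_nonneg hx.le (zero_le_one.trans hu.le)]

theorem EntireCoeff.isBigO_cpow_descSeries_mul (hD : EntireCoeff D) (hτ : 0 < τ) (hx : 0 < x)
    (s : ℂ) {k₀ : ℕ} (h₀ : D k₀ ≠ 0) (hlt : ∀ k < k₀, D k = 0) :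
    (fun u : ℝ => (u : ℂ) ^ (-(s + τ * k₀))) =O[atTop] fun u => descSeries D τ s (x * u) := by
  have hlead := (hD.isBigO_cpow_descSeries hτ s h₀ hlt).comp_tendsto
    (tendsto_id.const_mul_atTop hx)
  refine ((Asymptotics.isBigO_const_mul_self ((x : ℂ) ^ (s + τ * k₀)) _ atTop).congr' ?_
    EventuallyEq.rfl).trans hlead
  filter_upwards [eventually_gt_atTop 1] with u hu
  rw [Function.comp_apply, id, ofReal_mul_cpow hx hu, Complex.cpow_neg, Complex.cpow_neg,
    mul_inv_cancel_left₀]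
  exact Complex.cpow_ne_zero_iff.2 (Or.inl (Complex.ofReal_ne_zero.2 hx.ne'))

theorem EntireCoeff.exists_momentConvergent (hD : EntireCoeff D) (hK : MomentConvergent K s₀)
    (hτ : 0 < τ) (hx : 0 < x)
    (hint : IntegrableOn (fun u => K u * descSeries D τ s (x * u)) (Ioi 1)) :
    ∃ s₁, MomentConvergent K s₁ ∧ ∀ k, D k ≠ 0 → s₁.re ≤ (s + τ * k).re := by
  classical
  by_cases hzero : ∃ k, D k ≠ 0
  · refine ⟨s + τ * Nat.find hzero, hK.of_isBigO hint (hD.isBigO_cpow_descSeries_mul hτ hx s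
      (Nat.find_spec hzero) fun k hk => not_not.1 (Nat.find_min hzero hk)), fun k hk => ?_⟩
    simp only [Complex.add_re, Complex.re_ofReal_mul, Complex.natCast_re]
    gcongr
    exact Nat.find_min' hzero hk
  · exact ⟨s₀, hK, fun k hk => absurd ⟨k, hk⟩ hzero⟩

theorem EntireCoeff.mul_moment (hD : EntireCoeff D) (hK : MomentConvergent K s₀)
    (hle : ∀ k, D k ≠ 0 → s₀.re ≤ (s + τ * k).re) :
    EntireCoeff fun k => D k * moment K (s + τ * k) := by
  refine hD.of_norm_le (M := ∫ u in Ioi (1 : ℝ), ‖K u * (u : ℂ) ^ (-s₀)‖) fun k => ?_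
  rcases eq_or_ne (D k) 0 with h | h
  · simp [h]
  · rw [norm_mul, mul_comm]
    gcongr
    exact (norm_integral_le_integral_norm _).trans (hK.integral_norm_le (hle k h))

theorem EntireCoeff.integral_mul_descSeries (hD : EntireCoeff D) (hK : MomentConvergent K s₀)
    (hle : ∀ k, D k ≠ 0 → s₀.re ≤ (s + τ * k).re) {y : ℝ} (hy : 0 < y) :
    ∫ u in Ioi 1, K u * descSeries D τ s (y * u) =
      descSeries (fun k => D k * moment K (s + τ * k)) τ s y := by
  set F : ℕ → ℝ → ℂ := fun k u =>
    D k * (y : ℂ) ^ (-(s + τ * k)) * (K u * (u : ℂ) ^ (-(s + τ * k))) with hF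
  have hint (k : ℕ) : IntegrableOn (F k) (Ioi 1) := by
    rcases eq_or_ne (D k) 0 with h | h
    · simp [hF, h]
    · exact (hK.of_re_le (hle k h)).const_mul _
  have hsum : Summable fun k => ∫ u in Ioi (1 : ℝ), ‖F k u‖ := by
    refine ((hD.summable_norm τ s hy).mul_right
      (∫ u in Ioi (1 : ℝ), ‖K u * (u : ℂ) ^ (-s₀)‖)).of_nonneg_of_le
      (fun k => integral_nonneg fun u => norm_nonneg _) fun k => ?_
    simp only [hF, norm_mul _ (K _ * _), integral_const_mul]
    rcases eq_or_ne (D k) 0 with h | h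
    · simp [h]
    · exact mul_le_mul_of_nonneg_left (hK.integral_norm_le (hle k h)) (norm_nonneg _)
  have hFu : ∀ u ∈ Ioi (1 : ℝ), K u * descSeries D τ s (y * u) = ∑' k, F k u := fun u hu => by
    rw [descSeries, ← tsum_mul_left]
    refine tsum_congr fun k => ?_
    rw [ofReal_mul_cpow hy hu]
    ring
  rw [setIntegral_congr_fun measurableSet_Ioi hFu,
    ← (hasSum_integral_of_summable_integral_norm hint hsum).tsum_eq, descSeries]
  refine tsum_congr fun k => ?_
  rw [integral_const_mul, ← moment]
  ring

end Transform

section RightMSMIntegral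

variable {a a' b b' c s : ℂ} {f : ℝ → ℂ} {y : ℝ}

theorem rightMSMIntegrand_mul (a a' b b' c : ℂ) (f : ℝ → ℂ) {u : ℝ} (hy : 0 < y) (hu : 1 < u) :
    rightMSMIntegrand a a' b b' c f y (y * u) =
      (y : ℂ) ^ (c - 1) * (y : ℂ) ^ (-a) * (msmKernel a a' b b' c u * f (y * u)) := by
  rw [rightMSMIntegrand, msmKernel, show y * u - y = y * (u - 1) by ring,
    show y / (y * u) = 1 / u by field_simp, mul_div_cancel_left₀ u hy.ne', ofReal_mul_cpow hy hu,
    Complex.ofReal_mul, Complex.mul_cpow_ofReal_nonneg hy.le (sub_nonneg.2 hu.le)]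
  ring

theorem integrableOn_msmKernel_mul (hy : 0 < y)
    (h : IntegrableOn (rightMSMIntegrand a a' b b' c f y) (Ioi y)) :
    IntegrableOn (fun u => msmKernel a a' b b' c u * f (y * u)) (Ioi 1) := by
  have hyc : (y : ℂ) ≠ 0 := Complex.ofReal_ne_zero.2 hy.ne'
  have hne : (y : ℂ) ^ (c - 1) * (y : ℂ) ^ (-a) ≠ 0 :=
    mul_ne_zero (Complex.cpow_ne_zero_iff.2 (Or.inl hyc)) (Complex.cpow_ne_zero_iff.2 (Or.inl hyc))
  rw [← mul_one y, ← integrableOn_Ioi_comp_mul_left_iff _ _ hy, mul_one,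
    integrableOn_congr_fun (s := Ioi 1) (fun u hu => rightMSMIntegrand_mul a a' b b' c f hy hu)
      measurableSet_Ioi] at h
  exact (integrable_const_mul_iff hne.isUnit _).1 h

theorem rightMSMIntegral_eq (a a' b b' c : ℂ) (f : ℝ → ℂ) (hy : 0 < y) :
    rightMSMIntegral a a' b b' c f y = (y : ℂ) ^ (-a' + c - a) / Complex.Gamma c *
      ∫ u in Ioi 1, msmKernel a a' b b' c u * f (y * u) := by
  have hyc : (y : ℂ) ≠ 0 := Complex.ofReal_ne_zero.2 hy.ne'
  have hsubst := integral_comp_mul_left_Ioi' (rightMSMIntegrand a a' b b' c f y) 1 hy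
  rw [mul_one] at hsubst
  rw [rightMSMIntegral, ← hsubst, setIntegral_congr_fun measurableSet_Ioi
      (fun u hu => rightMSMIntegrand_mul a a' b b' c f hy hu),
    integral_const_mul, Complex.real_smul,
    show -a' + c - a = -a' + 1 + (c - 1) + -a by ring, Complex.cpow_add _ _ hyc,
    Complex.cpow_add _ _ hyc, Complex.cpow_add _ _ hyc, Complex.cpow_one]
  ring

variable {D : ℕ → ℂ} {τ : ℝ}

theorem msmKernel_mul_congr (hf : EqOn f (descSeries D τ s) (Ioi 0)) (hy : 0 < y) :
    EqOn (fun u => msmKernel a a' b b' c u * f (y * u))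
      (fun u => msmKernel a a' b b' c u * descSeries D τ s (y * u)) (Ioi 1) := by
  intro u (hu : 1 < u)
  simp only [hf (mem_Ioi.2 (mul_pos hy (zero_lt_one.trans hu)))]

theorem EntireCoeff.exists_momentConvergent_of_integrableOn (hD : EntireCoeff D) (hc : 0 < c.re)
    (hτ : 0 < τ) (hf : EqOn f (descSeries D τ s) (Ioi 0)) (hy : 0 < y)
    (hint : IntegrableOn (rightMSMIntegrand a a' b b' c f y) (Ioi y)) :
    ∃ s₁, MomentConvergent (msmKernel a a' b b' c) s₁ ∧
      ∀ k, D k ≠ 0 → s₁.re ≤ (s + τ * k).re := by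
  obtain ⟨s₀, hs₀⟩ := exists_momentConvergent_msmKernel hc a a' b b'
  exact hD.exists_momentConvergent hs₀ hτ hy
    ((integrableOn_msmKernel_mul hy hint).congr_fun (msmKernel_mul_congr hf hy) measurableSet_Ioi)

theorem EntireCoeff.rightMSMIntegral_eq_descSeries {s₀ : ℂ} (hD : EntireCoeff D)
    (hf : EqOn f (descSeries D τ s) (Ioi 0)) (hK : MomentConvergent (msmKernel a a' b b' c) s₀)
    (hle : ∀ k, D k ≠ 0 → s₀.re ≤ (s + τ * k).re) (hy : 0 < y) :
    rightMSMIntegral a a' b b' c f y =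
      descSeries (fun k => (Complex.Gamma c)⁻¹ * (D k * moment (msmKernel a a' b b' c) (s + τ * k)))
        τ (s + a + a' - c) y := by
  rw [rightMSMIntegral_eq a a' b b' c f hy,
    setIntegral_congr_fun measurableSet_Ioi (msmKernel_mul_congr hf hy),
    hD.integral_mul_descSeries hK hle hy, div_mul_eq_mul_div, cpow_mul_descSeries _ _ _ _ hy,
    div_eq_inv_mul, descSeries_mul_left, show s - (-a' + c - a) = s + a + a' - c by ring]

end RightMSMIntegral

/-! ### The fractional derivative -/

section RightMSMDeriv

/-- The Gamma quotient by which the right-sided Marichev–Saigo–Maeda derivative acts on powers: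
it maps `t ^ (-s)` to `msmDerivGamma lam lam' ξ ξ' γ s * x ^ (lam + lam' - γ - s)`. -/
noncomputable def msmDerivGamma (lam lam' ξ ξ' γ s : ℂ) : ℂ :=
  Complex.Gamma (ξ' + s) * Complex.Gamma (-lam - lam' + γ + s) *
      Complex.Gamma (-lam' - ξ + γ + s) /
    (Complex.Gamma s * Complex.Gamma (-lam' + ξ' + s) * Complex.Gamma (-lam - lam' - ξ + γ + s))

variable {lam lam' ξ ξ' γ s : ℂ} {n : ℕ}

theorem re_neg_add_natCast_pos (hn : γ.re < n) : 0 < (-γ + n).re := by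
  rw [Complex.add_re, Complex.neg_re, Complex.natCast_re]
  linarith

theorem moment_msmKernel_mul_poch_eq_msmDerivGamma (hn : γ.re < n)
    (hs : MomentConvergent (msmKernel (-lam') (-lam) (-ξ') (-ξ + n) (-γ + n)) s)
    (h₁ : Complex.Gamma (ξ' + s) ≠ 0) (h₂ : Complex.Gamma (-lam - lam' + γ + s) ≠ 0)
    (h₃ : Complex.Gamma (-lam' - ξ + γ + s) ≠ 0) :
    moment (msmKernel (-lam') (-lam) (-ξ') (-ξ + n) (-γ + n)) s *
        poch (s - lam - lam' + γ - n) n =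
      Complex.Gamma (-γ + n) * msmDerivGamma lam lam' ξ ξ' γ s := by
  have e₁ : s - -ξ' = ξ' + s := by ring
  have e₂ : s + -lam' + -lam - (-γ + n) = s - lam - lam' + γ - n := by ring
  have e₃ : s - lam - lam' + γ - n + n = -lam - lam' + γ + s := by ring
  have e₄ : s + -lam' + (-ξ + n) - (-γ + n) = -lam' - ξ + γ + s := by ring
  have e₅ : s + -lam' - -ξ' = -lam' + ξ' + s := by ring
  have e₆ : s + -lam' + -lam + (-ξ + n) - (-γ + n) = -lam - lam' - ξ + γ + s := by ring
  have hc := re_neg_add_natCast_pos hn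
  have h := moment_msmKernel_mul_poch hc (n := n) hs
  rw [e₁, e₂, e₃, e₄, e₅, e₆] at h
  rw [h h₁ h₂ h₃, msmDerivGamma, mul_div_assoc]

theorem EntireCoeff.rightMSM_descSeries {D : ℕ → ℂ} {τ x : ℝ} {f : ℝ → ℂ} (hD : EntireCoeff D)
    (hτ : 0 < τ) (hn : γ.re < n) (hf : EqOn f (descSeries D τ s) (Ioi 0)) (hx : 0 < x)
    (hint : IntegrableOn
      (rightMSMIntegrand (-lam') (-lam) (-ξ') (-ξ + n) (-γ + n) f x) (Ioi x))
    (hΓ : ∀ k : ℕ, Complex.Gamma (ξ' + (s + τ * k)) ≠ 0 ∧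
      Complex.Gamma (-lam - lam' + γ + (s + τ * k)) ≠ 0 ∧
      Complex.Gamma (-lam' - ξ + γ + (s + τ * k)) ≠ 0) :
    EntireCoeff (fun k => D k * msmDerivGamma lam lam' ξ ξ' γ (s + τ * k)) ∧
      ContDiffOn ℝ n (rightMSMIntegral (-lam') (-lam) (-ξ') (-ξ + n) (-γ + n) f) (Ioi 0) ∧
      ∀ y : ℝ, 0 < y →
        (-1) ^ n * iteratedDeriv n
            (rightMSMIntegral (-lam') (-lam) (-ξ') (-ξ + n) (-γ + n) f) y =
          descSeries (fun k => D k * msmDerivGamma lam lam' ξ ξ' γ (s + τ * k)) τ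
            (s - lam - lam' + γ) y := by
  set K := msmKernel (-lam') (-lam) (-ξ') (-ξ + n) (-γ + n)
  set e := s - lam - lam' + γ - n with he
  have hc := re_neg_add_natCast_pos hn
  have hΓc := Complex.Gamma_ne_zero_of_re_pos hc
  obtain ⟨s₁, hs₁, hle⟩ := hD.exists_momentConvergent_of_integrableOn hc hτ hf hx hint
  set E : ℕ → ℂ := fun k => (Complex.Gamma (-γ + n))⁻¹ * (D k * moment K (s + τ * k)) with hEdef
  have hE : EntireCoeff E := (hD.mul_moment hs₁ hle).of_norm_le fun k => (norm_mul _ _).le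
  have hI : EqOn (rightMSMIntegral (-lam') (-lam) (-ξ') (-ξ + n) (-γ + n) f)
      (descSeries E τ e) (Ioi 0) := fun y hy => by
    rw [hD.rightMSMIntegral_eq_descSeries hf hs₁ hle hy, he,
      show s + -lam' + -lam - (-γ + n) = s - lam - lam' + γ - n by ring]
  have hEk (k : ℕ) : E k * poch (e + τ * k) n =
      D k * msmDerivGamma lam lam' ξ ξ' γ (s + τ * k) := by
    rcases eq_or_ne (D k) 0 with h | h
    · simp [hEdef, h]
    · obtain ⟨h₁, h₂, h₃⟩ := hΓ k
      have hk := moment_msmKernel_mul_poch_eq_msmDerivGamma hn (hs₁.of_re_le (hle k h)) h₁ h₂ h₃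
      rw [show s + τ * k - lam - lam' + γ - n = e + τ * k by rw [he]; ring] at hk
      simp only [hEdef]
      rw [mul_assoc, mul_assoc (D k), hk]
      field_simp
  refine ⟨?_, (hE.contDiffOn_descSeries τ e n).congr hI, fun y hy => ?_⟩
  · simpa only [hEk] using hE.mul_poch e τ n
  · rw [(hI.eventuallyEq_of_mem (Ioi_mem_nhds hy)).iteratedDeriv_eq,
      hE.iteratedDeriv_descSeries τ e n hy, he, sub_add_cancel]
    simp only [← he, hEk]

end RightMSMDeriv

section StruveImage

theorem FoxWrightDefined.Gamma_ne_zero {m : ℕ} {A : Fin m → ℂ × ℝ} (hA : FoxWrightDefined A)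
    (i : Fin m) (k : ℕ) : Complex.Gamma ((A i).1 + ((A i).2 : ℂ) * k) ≠ 0 :=
  Complex.Gamma_ne_zero (hA i k)

theorem foxWrightTerm_struve (lam lam' ξ ξ' γ ρ p b μ : ℂ) (a : ℕ) (η α : ℝ) (z : ℂ) (k : ℕ) :
    foxWrightTerm (struveUpper lam lam' ξ ξ' γ ρ p)
        (struveLower lam lam' ξ ξ' γ ρ a p b η α μ) z k =
      msmDerivGamma lam lam' ξ ξ' γ (ρ + p + 1 + 2 * k) * z ^ k /
        (Complex.Gamma (α * k + μ) * Complex.Gamma (a * k + p / η + (b + 2) / 2)) := by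
  have hone : Complex.Gamma (1 + k) = k.factorial := by
    rw [add_comm, Complex.Gamma_nat_eq_factorial]
  have hk : (k.factorial : ℂ) ≠ 0 := Nat.cast_ne_zero.2 k.factorial_ne_zero
  simp only [foxWrightTerm, Fin.prod_univ_four, Fin.prod_univ_five, struveUpper, struveLower,
    Matrix.cons_val, Complex.ofReal_one, one_mul, hone, Complex.ofReal_ofNat,
    Complex.ofReal_natCast, msmDerivGamma, ← add_assoc]
  rw [add_comm (α * k : ℂ) μ, add_assoc (a * k : ℂ), add_comm (a * k : ℂ)]
  field_simp

theorem cpow_div_mul_foxWrightTerm_struve (lam lam' ξ ξ' γ ρ p b c μ : ℂ) (a : ℕ) (η α : ℝ)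
    {x : ℝ} (hx : 0 < x) (k : ℕ) :
    (x : ℂ) ^ (lam + lam' - γ - ρ - p - 1) / 2 ^ (p + 1) *
        foxWrightTerm (struveUpper lam lam' ξ ξ' γ ρ p)
          (struveLower lam lam' ξ ξ' γ ρ a p b η α μ) (-c / (4 * (x : ℂ) ^ 2)) k =
      struveCoeff a p b c η α μ k *
        msmDerivGamma lam lam' ξ ξ' γ (ρ + p + 1 + (2 : ℝ) * k) *
        (x : ℂ) ^ (-(ρ + p + 1 - lam - lam' + γ + (2 : ℝ) * k)) := by
  have hpow : (x : ℂ) ^ (-(ρ + p + 1 - lam - lam' + γ + 2 * k)) =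
      (x : ℂ) ^ (lam + lam' - γ - ρ - p - 1) * (((x : ℂ) ^ 2) ^ k)⁻¹ := by
    rw [show -(ρ + p + 1 - lam - lam' + γ + 2 * (k : ℂ)) =
        (lam + lam' - γ - ρ - p - 1) + -(2 * k) by ring,
      Complex.cpow_add _ _ (Complex.ofReal_ne_zero.2 hx.ne'), Complex.cpow_neg _ (2 * (k : ℂ)),
      Complex.cpow_mul_nat, Complex.cpow_ofNat]
  rw [foxWrightTerm_struve, struveCoeff, two_cpow_two_mul_add, Complex.ofReal_ofNat, hpow,
    div_pow, mul_pow]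
  ring

end StruveImage

theorem theorem4_general (lam lam' ξ ξ' γ ρ p b c μ : ℂ) (a n : ℕ) (η α : ℝ) (_hη : η ≠ 0)
    (hα : 0 < α) (hn : γ.re < n) {x₀ : ℝ} (hx₀ : 0 < x₀)
    (hleft : IntegrableOn (rightMSMIntegrand (-lam') (-lam) (-ξ') (-ξ + n) (-γ + n)
      (fun t : ℝ => (t : ℂ) ^ (-ρ) * genStruve a p b c η α μ (1 / (t : ℂ))) x₀) (Ioi x₀))
    (hright : FoxWrightDefined (struveUpper lam lam' ξ ξ' γ ρ p)) :
    ContDiffOn ℝ n (rightMSMIntegral (-lam') (-lam) (-ξ') (-ξ + n) (-γ + n)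
        (fun t : ℝ => (t : ℂ) ^ (-ρ) * genStruve a p b c η α μ (1 / (t : ℂ)))) (Ioi 0) ∧
      ∀ x : ℝ, 0 < x →
        Summable (foxWrightTerm (struveUpper lam lam' ξ ξ' γ ρ p)
          (struveLower lam lam' ξ ξ' γ ρ a p b η α μ) (-c / (4 * (x : ℂ) ^ 2))) ∧
        (-1) ^ n * iteratedDeriv n (rightMSMIntegral (-lam') (-lam) (-ξ') (-ξ + n) (-γ + n)
            (fun t : ℝ => (t : ℂ) ^ (-ρ) * genStruve a p b c η α μ (1 / (t : ℂ)))) x =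
          (x : ℂ) ^ (lam + lam' - γ - ρ - p - 1) / (2 : ℂ) ^ (p + 1) *
            foxWright (struveUpper lam lam' ξ ξ' γ ρ p)
              (struveLower lam lam' ξ ξ' γ ρ a p b η α μ) (-c / (4 * (x : ℂ) ^ 2)) := by
  have hΓ (k : ℕ) : Complex.Gamma (ξ' + (ρ + p + 1 + (2 : ℝ) * k)) ≠ 0 ∧
      Complex.Gamma (-lam - lam' + γ + (ρ + p + 1 + (2 : ℝ) * k)) ≠ 0 ∧
      Complex.Gamma (-lam' - ξ + γ + (ρ + p + 1 + (2 : ℝ) * k)) ≠ 0 := by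
    simp only [← add_assoc]
    exact ⟨hright.Gamma_ne_zero 1 k, hright.Gamma_ne_zero 2 k, hright.Gamma_ne_zero 3 k⟩
  obtain ⟨hE, hcont, hderiv⟩ := (entireCoeff_struveCoeff a p b c η hα μ).rightMSM_descSeries
    two_pos hn (fun t ht => cpow_mul_genStruve a p b c ρ μ η α ht) hx₀ hleft hΓ
  refine ⟨hcont, fun x hx => ⟨?_, ?_⟩⟩
  · have hne : (x : ℂ) ^ (lam + lam' - γ - ρ - p - 1) / (2 : ℂ) ^ (p + 1) ≠ 0 :=
      div_ne_zero (Complex.cpow_ne_zero_iff.2 (Or.inl (Complex.ofReal_ne_zero.2 hx.ne')))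
        (Complex.cpow_ne_zero_iff.2 (Or.inl two_ne_zero))
    refine (summable_mul_left_iff hne).1 ?_
    simp only [cpow_div_mul_foxWrightTerm_struve _ _ _ _ _ _ _ _ _ _ _ _ _ hx]
    exact (hE.summable_norm 2 _ hx).of_norm
  · rw [hderiv x hx, foxWright, ← tsum_mul_left, descSeries]
    exact tsum_congr fun k =>
      (cpow_div_mul_foxWrightTerm_struve lam lam' ξ ξ' γ ρ p b c μ a η α hx k).symm

theorem lt_msmOrder (γ : ℂ) : γ.re < msmOrder γ :=
  (Int.lt_floor_add_one γ.re).trans_le (by exact_mod_cast Int.self_le_toNat (⌊γ.re⌋ + 1))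

theorem theorem4 (lam lam' ξ ξ' γ ρ p b c μ : ℂ) (a : ℕ) (η α : ℝ) (hη : 0 < η) (hα : 0 < α)
    (hγ : -1 ≤ γ.re) (x : ℝ) (hx : 0 < x)
    (hleft : ∀ᶠ y in 𝓝 x, RightMSMDerivIntegrable lam lam' ξ ξ' γ
      (fun t : ℝ => (t : ℂ) ^ (-ρ) * genStruve a p b c η α μ (1 / (t : ℂ))) y)
    (hright : FoxWrightDefined (struveUpper lam lam' ξ ξ' γ ρ p)) :
    ContDiffAt ℝ (msmOrder γ)
        (rightMSMDerivIntegral lam lam' ξ ξ' γ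
          (fun t : ℝ => (t : ℂ) ^ (-ρ) * genStruve a p b c η α μ (1 / (t : ℂ)))) x ∧
      Summable (foxWrightTerm (struveUpper lam lam' ξ ξ' γ ρ p)
        (struveLower lam lam' ξ ξ' γ ρ a p b η α μ) (-c / (4 * (x : ℂ) ^ 2))) ∧
      rightMSMDeriv lam lam' ξ ξ' γ
          (fun t : ℝ => (t : ℂ) ^ (-ρ) * genStruve a p b c η α μ (1 / (t : ℂ))) x =
        (x : ℂ) ^ (lam + lam' - γ - ρ - p - 1) / (2 : ℂ) ^ (p + 1) *
          foxWright (struveUpper lam lam' ξ ξ' γ ρ p)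
            (struveLower lam lam' ξ ξ' γ ρ a p b η α μ) (-c / (4 * (x : ℂ) ^ 2)) :=
  have ⟨hcont, hx'⟩ := theorem4_general lam lam' ξ ξ' γ ρ p b c μ a (msmOrder γ) η α hη.ne' hα
    (lt_msmOrder γ) hx hleft.self_of_nhds hright
  ⟨hcont.contDiffAt (Ioi_mem_nhds hx), hx' x hx⟩
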